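/- **Proposition.** Let $U\subseteq\mathbb R^4$ be open (a coordinate chart of spacetime), let $g_{\mu\nu}$ be a smooth Lorentzian metric on $U$ with Levi-Civita connection $\nabla$ and $dV_g=\sqrt{-\det g}\;dt\wedge dx\wedge dy\wedge dz$, and let $f^a{}_{bc}$ be the structure constants of a finite-dimensional real Lie algebra in a basis $(T_a)$ that is orthonormal for an ad-invariant inner product $\delta_{ab}$ (used to raise and lower colour indices). Let $\mathrm g,\xi\in\mathbb R\setminus\{0\}$. Consider the supercommutative algebra of polynomials, with coefficients in $C^\infty(U)$, in the even fields $A^a_\mu$, $b^a$, the odd fields $c^a$ (ghost), $\overline c^a$ (antighost) and all their derivatives. Let $Q$ and $\overline Q$ be the odd left derivations of this algebra that annihilate $C^\infty(U)$, commute with the total derivatives $\partial_\mu$ and satisfy $$QA^a_\mu=\tfrac1\xi\partial_\mu c^a+\mathrm g f^a{}_{bc}c^bA^c_\mu,\quad Qc^a=\tfrac{\mathrm g}2f^a{}_{bc}c^bc^c,\quad Q\overline c^a=\tfrac1\xi b^a,\quad Qb^a=0,$$ $$\overline QA^a_\mu=\tfrac1\xi\partial_\mu\overline c^a+\mathrm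 g f^a{}_{bc}\overline c^bA^c_\mu,\quad \overline Qc^a=-\tfrac1\xi b^a+\mathrm g f^a{}_{bc}\overline c^bc^c,\quad \overline Q\,\overline c^a=\tfrac{\mathrm g}2f^a{}_{bc}\overline c^b\overline c^c,\quad \overline Qb^a=\mathrm g f^a{}_{bc}\overline c^bb^c,$$ and put $\mathcal Q=Q\circ\overline Q$, $L^a=\mathrm g\,g^{\mu\nu}\nabla_\mu A^a_\nu$ and $$G=-\tfrac\xi2\left(\delta_{ab}g^{\mu\nu}A^a_\mu A^b_\nu-\overline c_ac^a\right)dV_g .$$ Write $\simeq$ for equality of Lagrange densities up to a total divergence. Then: 1. $$\mathcal QG\simeq\Big(\tfrac1{2\xi}b_ab^a+\tfrac1{\mathrm g\xi}b_aL^a+\tfrac1\xi g^{\mu\nu}(\partial_\mu\overline c_a)(\partial_\nu c^a)+\mathrm g\,g^{\mu\nu}f^a{}_{bc}(\partial_\mu\overline c_a)c^bA^c_\nu-\tfrac{\mathrm g}2f^a{}_{bc}b_a\overline c^bc^c-\tfrac{\mathrm g^2\xi}8f^a{}_{bc}f_{ade}\overline c^b\overline c^cc^dc^e\Big)dV_g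 .$$ 2. Express $\mathcal QG$ through the shifted auxiliary field $b'^a=b^a-\frac{\mathrm g\xi}2f^a{}_{bc}\overline c^bc^c$ by substituting $b^a=b'^a+\frac{\mathrm g\xi}2f^a{}_{bc}\overline c^bc^c$. The Euler–Lagrange equation of $b'$ for the resulting density has the unique solution $b'^a=-\frac1{\mathrm g}L^a$. 3. Inserting this solution gives the symmetric gauge fixing and ghost Lagrange density $$\begin{aligned}\mathcal L_{\text{YM-GF-Ghost}}\simeq{}&\tfrac1\xi\Big(-\tfrac1{2\mathrm g^2}\delta_{ab}L^aL^b+g^{\mu\nu}(\partial_\mu\overline c_a)(\partial_\nu c^a)\Big)dV_g\\&+\tfrac{\mathrm g}2g^{\mu\nu}f^a{}_{bc}\Big((\partial_\mu\overline c_a)c^bA^c_\nu-\overline c_a(\partial_\mu c^b)A^c_\nu\Big)dV_g-\tfrac{\mathrm g^2\xi}{16}f^a{}_{bc}f_{ade}\overline c^b\overline c^cc^dc^e\,dV_g .\end{aligned}$$ -/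

import Mathlib

open scoped ContDiff TensorProduct

noncomputable section

namespace QYM

/-! ## Smooth functions on a coordinate chart of spacetime -/

/-- Coordinates `(t, x, y, z)`. -/
abbrev Coord : Type := Fin 4 → ℝ

/-- A function on the open set `U`, extended by zero to all of `ℝ⁴`. -/
def extendZero {U : TopologicalSpace.Opens Coord} (h : U → ℝ) : Coord → ℝ :=
  Function.extend Subtype.val h 0

theorem extendZero_apply {U : TopologicalSpace.Opens Coord} (h : U → ℝ) (x : U) :
    extendZero h x = h x :=
  Subtype.val_injective.extend_apply h 0 x

theorem contDiffOn_extendZero {U : TopologicalSpace.Opens Coord} {h : U → ℝ} {F : Coord → ℝ}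
    (hF : ContDiffOn ℝ ∞ F U) (hh : ∀ x : U, h x = F x) : ContDiffOn ℝ ∞ (extendZero h) U :=
  hF.congr fun x hx => by rw [← hh ⟨x, hx⟩]; exact extendZero_apply h ⟨x, hx⟩

/-- The `ℝ`-algebra of smooth real functions on the open set `U ⊆ ℝ⁴`. -/
def SmoothFun (U : TopologicalSpace.Opens Coord) : Subalgebra ℝ (U → ℝ) where
  carrier := {h | ContDiffOn ℝ ∞ (extendZero h) U}
  mul_mem' {a b} ha hb := contDiffOn_extendZero (ha.mul hb) fun x => by
    simp [extendZero_apply]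
  add_mem' {a b} ha hb := contDiffOn_extendZero (ha.add hb) fun x => by
    simp [extendZero_apply]
  algebraMap_mem' r := contDiffOn_extendZero (F := fun _ => r) contDiffOn_const fun x => by
    simp

theorem SmoothFun.differentiableAt {U : TopologicalSpace.Opens Coord} (h : SmoothFun U) (x : U) :
    DifferentiableAt ℝ (extendZero h.1) x :=
  ((h.2.contDiffAt (U.isOpen.mem_nhds x.2)).differentiableAt (by simp))

theorem fderiv_extendZero_congr {U : TopologicalSpace.Opens Coord} {h : U → ℝ} {F : Coord → ℝ}
    (hh : ∀ x : U, h x = F x) (x : U) : fderiv ℝ (extendZero h) x = fderiv ℝ F x := by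
  apply Filter.EventuallyEq.fderiv_eq
  filter_upwards [U.isOpen.mem_nhds x.2] with y hy
  rw [← hh ⟨y, hy⟩]; exact extendZero_apply h ⟨y, hy⟩

/-- The coordinate derivative `∂_μ` of smooth functions on `U`. -/
def partialDeriv {U : TopologicalSpace.Opens Coord} (μ : Fin 4) :
    SmoothFun U →ₗ[ℝ] SmoothFun U where
  toFun h := ⟨fun x => fderiv ℝ (extendZero h.1) x (Pi.single μ 1),
    contDiffOn_extendZero (F := fun x => fderiv ℝ (extendZero h.1) x (Pi.single μ 1))
      ((h.2.fderiv_of_isOpen U.isOpen (by simp)).clm_apply contDiffOn_const) fun _ => rfl⟩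
  map_add' a b := by
    ext x
    have : fderiv ℝ (extendZero (a + b).1) x =
        fderiv ℝ (fun y => extendZero a.1 y + extendZero b.1 y) x :=
      fderiv_extendZero_congr (fun x => by simp [extendZero_apply]) x
    simp only [this]
    rw [fderiv_fun_add (SmoothFun.differentiableAt a x) (SmoothFun.differentiableAt b x)]
    rfl
  map_smul' r a := by
    ext x
    have : fderiv ℝ (extendZero (r • a).1) x =
        fderiv ℝ (fun y => r • extendZero a.1 y) x :=
      fderiv_extendZero_congr (fun x => by simp [extendZero_apply]) x
    simp only [this]
    rw [fderiv_fun_const_smul (SmoothFun.differentiableAt a x)]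
    rfl

/-- A Lorentzian metric on `U`: a smooth symmetric matrix `g_{μν}` with negative determinant
(in dimension four this means exactly that the signature is `(1, 3)` or `(3, 1)`). -/
structure LorentzMetric (U : TopologicalSpace.Opens Coord) where
  /-- the components `g_{μν}` -/
  comp : Matrix (Fin 4) (Fin 4) (SmoothFun U)
  symm : comp.IsSymm
  det_neg : ∀ x : U, (comp.det : U → ℝ) x < 0

namespace LorentzMetric

variable {U : TopologicalSpace.Opens Coord} (m : LorentzMetric U)

/-- The inverse metric `g^{μν}`. -/
def inv (μ ν : Fin 4) : SmoothFun U := m.comp⁻¹ μ ν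

/-- `√(-det g)`, the coefficient of the volume form `dV_g` with respect to `dt ∧ dx ∧ dy ∧ dz`. -/
def vol : SmoothFun U :=
  ⟨fun x => √(-(m.comp.det : U → ℝ) x),
    contDiffOn_extendZero (F := fun x => √(-extendZero m.comp.det.1 x))
      (m.comp.det.2.neg.sqrt fun x hx => by
        have := m.det_neg ⟨x, hx⟩
        rw [extendZero_apply m.comp.det.1 ⟨x, hx⟩]
        exact (neg_pos.mpr this).ne')
      fun x => by rw [extendZero_apply]⟩

/-- The Christoffel symbols `Γ^ρ_{μν}` of the Levi-Civita connection. -/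
def christoffel (ρ μ ν : Fin 4) : SmoothFun U :=
  (1 / 2 : ℝ) • ∑ σ, m.inv ρ σ * (partialDeriv μ (m.comp σ ν) + partialDeriv ν (m.comp σ μ)
    - partialDeriv σ (m.comp μ ν))

end LorentzMetric

/-! ## The free supercommutative algebra on the jets of the fields -/

/-- The components of the fields: the gauge field `A^a_μ`, the ghost `c^a`, the antighost `c̄^a`
and the Lautrup–Nakanishi auxiliary field `b^a`, where `a` runs over the colour indices `ι`. -/
inductive FieldComp (ι : Type*)
  | gaugeField (μ : Fin 4) (a : ι)
  | ghost (a : ι)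
  | antighost (a : ι)
  | aux (a : ι)

/-- The parity: ghost and antighost are odd, gauge field and auxiliary field are even. -/
def FieldComp.parity {ι : Type*} : FieldComp ι → ℕ
  | .gaugeField _ _ => 0
  | .ghost _ => 1
  | .antighost _ => 1
  | .aux _ => 0

/-- A jet coordinate `∂_I φ`: a field component together with a multi-index of derivatives. -/
abbrev Jet (ι : Type*) : Type _ := FieldComp ι × (Fin 4 → ℕ)

/-- The supercommutation relations `u v = (-1)^{|u||v|} v u` between jet coordinates. -/
inductive SuperRel (ι : Type*) : FreeAlgebra ℝ (Jet ι) → FreeAlgebra ℝ (Jet ι) → Prop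
  | swap (u v : Jet ι) : SuperRel ι (FreeAlgebra.ι ℝ u * FreeAlgebra.ι ℝ v)
      ((-1 : ℝ) ^ (u.1.parity * v.1.parity) • (FreeAlgebra.ι ℝ v * FreeAlgebra.ι ℝ u))

/-- The free supercommutative `ℝ`-algebra on the jet coordinates. -/
def JetAlg (ι : Type*) : Type _ := RingQuot (SuperRel ι)

instance (ι : Type*) : Ring (JetAlg ι) := inferInstanceAs (Ring (RingQuot (SuperRel ι)))

instance (ι : Type*) : Algebra ℝ (JetAlg ι) :=
  inferInstanceAs (Algebra ℝ (RingQuot (SuperRel ι)))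

section JetAlg

variable {ι : Type*}

/-- A jet coordinate as an element of the jet algebra. -/
def jet (u : Jet ι) : JetAlg ι := RingQuot.mkAlgHom ℝ (SuperRel ι) (FreeAlgebra.ι ℝ u)

theorem jet_mul_jet (u v : Jet ι) :
    jet u * jet v = (-1 : ℝ) ^ (u.1.parity * v.1.parity) • (jet v * jet u) := by
  have := RingQuot.mkAlgHom_rel ℝ (SuperRel.swap u v)
  rw [map_mul, map_smul, map_mul] at this
  exact this

/-- The algebra homomorphism with prescribed supercommuting values on the jet coordinates. -/
def jetLift {B : Type*} [Ring B] [Algebra ℝ B] (v : Jet ι → B)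
    (hv : ∀ s t, v s * v t = (-1 : ℝ) ^ (s.1.parity * t.1.parity) • (v t * v s)) :
    JetAlg ι →ₐ[ℝ] B :=
  RingQuot.liftAlgHom ℝ ⟨FreeAlgebra.lift ℝ v, by
    rintro _ _ ⟨s, t⟩
    simpa using hv s t⟩

theorem jetLift_jet {B : Type*} [Ring B] [Algebra ℝ B] (v : Jet ι → B)
    (hv : ∀ s t, v s * v t = (-1 : ℝ) ^ (s.1.parity * t.1.parity) • (v t * v s)) (u : Jet ι) :
    jetLift v hv (jet u) = v u := by
  have : (RingQuot.liftAlgHom ℝ ⟨FreeAlgebra.lift ℝ v, fun a b h => by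
      obtain ⟨s, t⟩ := h; simpa using hv s t⟩) (RingQuot.mkAlgHom ℝ (SuperRel ι)
      (FreeAlgebra.ι ℝ u)) = v u := by simp
  exact this

theorem jet_induction {P : JetAlg ι → Prop} (hc : ∀ r : ℝ, P (algebraMap ℝ _ r))
    (hj : ∀ u, P (jet u)) (hm : ∀ x y, P x → P y → P (x * y))
    (ha : ∀ x y, P x → P y → P (x + y)) (x : JetAlg ι) : P x := by
  obtain ⟨y, rfl⟩ := RingQuot.mkAlgHom_surjective ℝ (SuperRel ι) x
  induction y using FreeAlgebra.induction with
  | grade0 r => rw [AlgHom.commutes]; exact hc r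
  | grade1 u => exact hj u
  | mul a b ha' hb' => rw [map_mul]; exact hm _ _ ha' hb'
  | add a b ha' hb' => rw [map_add]; exact ha _ _ ha' hb'

/-- The parity automorphism: `1` on even and `-1` on odd elements. -/
def parityHom : JetAlg ι →ₐ[ℝ] JetAlg ι :=
  jetLift (fun u => (-1 : ℝ) ^ u.1.parity • jet u) fun s t => by
    simp only [smul_mul_smul_comm, jet_mul_jet s t, smul_smul]
    congr 1
    ring

theorem parityHom_jet (u : Jet ι) : parityHom (jet u) = (-1 : ℝ) ^ u.1.parity • jet u :=
  jetLift_jet _ _ u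

theorem parityHom_pow_jet (p : ℕ) (u : Jet ι) :
    (parityHom ^ p) (jet u) = (-1 : ℝ) ^ (p * u.1.parity) • jet u := by
  induction p with
  | zero => simp
  | succ n ih =>
    rw [pow_succ', AlgHom.mul_apply, ih, map_smul, parityHom_jet, smul_smul]
    congr 1
    ring

theorem jet_mul (u : Jet ι) (x : JetAlg ι) :
    jet u * x = (parityHom ^ u.1.parity) x * jet u := by
  induction x using jet_induction with
  | hc r => simp [Algebra.commutes]
  | hj v => rw [parityHom_pow_jet, jet_mul_jet, smul_mul_assoc]
  | hm x y hx hy => rw [← mul_assoc, hx, mul_assoc, hy, map_mul, mul_assoc]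
  | ha x y hx hy => rw [mul_add, hx, hy, map_add, add_mul]

theorem parityHom_pow_of_homogeneous {x : JetAlg ι} {k : ℕ}
    (hx : parityHom x = (-1 : ℝ) ^ k • x) (p : ℕ) :
    (parityHom ^ p) x = (-1 : ℝ) ^ (p * k) • x := by
  induction p with
  | zero => simp
  | succ n ih =>
    rw [pow_succ', AlgHom.mul_apply, ih, map_smul, hx, smul_smul]
    congr 1
    ring

/-- The algebra homomorphism `x ↦ ((σ^p x, d x), (0, x))` that encodes the left superderivation
`d` of parity `p` with `d u = v u` on jet coordinates; here `σ` is the parity automorphism. -/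
def superDerHom (p : ℕ) (v : Jet ι → JetAlg ι)
    (hv : ∀ u, parityHom (v u) = (-1 : ℝ) ^ (p + u.1.parity) • v u) :
    JetAlg ι →ₐ[ℝ] Matrix (Fin 2) (Fin 2) (JetAlg ι) :=
  jetLift (fun u => !![(parityHom ^ p) (jet u), v u; 0, jet u]) fun s t => by
    have key : ∀ s t : Jet ι, (parityHom ^ p) (jet s) * v t =
        (-1 : ℝ) ^ (s.1.parity * t.1.parity) • (v t * jet s) := fun s t => by
      rw [parityHom_pow_jet, smul_mul_assoc, jet_mul, parityHom_pow_of_homogeneous (hv t),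
        smul_mul_assoc, smul_smul]
      congr 1
      rw [← pow_add, show p * s.1.parity + s.1.parity * (p + t.1.parity)
        = 2 * (p * s.1.parity) + s.1.parity * t.1.parity by ring, pow_add, pow_mul]
      simp
    have key' : v s * jet t =
        (-1 : ℝ) ^ (s.1.parity * t.1.parity) • ((parityHom ^ p) (jet t) * v s) := by
      rw [key t s, smul_smul, ← pow_add, mul_comm t.1.parity, ← two_mul, pow_mul]
      simp
    rw [Matrix.mul_fin_two, Matrix.mul_fin_two, Matrix.smul_of]
    congr 1
    simp only [Matrix.smul_cons, Matrix.smul_empty, mul_zero, zero_mul, add_zero, zero_add,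
      smul_zero, smul_add]
    rw [← key', key s t, jet_mul_jet s t, ← map_mul, jet_mul_jet s t, map_smul, map_mul,
      add_comm (v s * jet t)]

/-- The left superderivation `d` of the jet algebra of parity `p` (`0` even, `1` odd) that is
prescribed by `d u = v u` on jet coordinates:
`d (x y) = (d x) y + σ^p(x) (d y)`. -/
def superDer (p : ℕ) (v : Jet ι → JetAlg ι)
    (hv : ∀ u, parityHom (v u) = (-1 : ℝ) ^ (p + u.1.parity) • v u) :
    JetAlg ι →ₗ[ℝ] JetAlg ι where
  toFun x := superDerHom p v hv x 0 1
  map_add' x y := by simp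
  map_smul' r x := by simp

section superDer

variable (p : ℕ) (v : Jet ι → JetAlg ι)
  (hv : ∀ u, parityHom (v u) = (-1 : ℝ) ^ (p + u.1.parity) • v u)

theorem superDer_jet (u : Jet ι) : superDer p v hv (jet u) = v u := by
  simp [superDer, superDerHom, jetLift_jet]

theorem superDerHom_diag (x : JetAlg ι) :
    superDerHom p v hv x 0 0 = (parityHom ^ p) x ∧ superDerHom p v hv x 1 0 = 0 ∧
      superDerHom p v hv x 1 1 = x := by
  induction x using jet_induction with
  | hc r => simp [Matrix.algebraMap_matrix_apply]
  | hj u => simp [superDerHom, jetLift_jet]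
  | hm x y hx hy => simp [Matrix.mul_apply, Fin.sum_univ_two, hx, hy]
  | ha x y hx hy => simp [hx, hy]

theorem superDer_mul (x y : JetAlg ι) :
    superDer p v hv (x * y) = superDer p v hv x * y + (parityHom ^ p) x * superDer p v hv y := by
  have hx := superDerHom_diag p v hv x
  have hy := superDerHom_diag p v hv y
  simp only [superDer, LinearMap.coe_mk, AddHom.coe_mk, map_mul, Matrix.mul_apply,
    Fin.sum_univ_two, hx.1, hy.2.2]
  rw [add_comm]

theorem superDer_algebraMap (r : ℝ) : superDer p v hv (algebraMap ℝ _ r) = 0 := by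
  simp [superDer, Matrix.algebraMap_matrix_apply]

theorem parityHom_superDer (x : JetAlg ι) :
    parityHom (superDer p v hv x) = (-1 : ℝ) ^ p • superDer p v hv (parityHom x) := by
  have comm : ∀ x : JetAlg ι, parityHom ((parityHom ^ p) x) = (parityHom ^ p) (parityHom x) :=
    fun x => by rw [← AlgHom.mul_apply, ← AlgHom.mul_apply, ← pow_succ', pow_succ]
  induction x using jet_induction with
  | hc r => simp [superDer_algebraMap]
  | hj u =>
    rw [superDer_jet, hv, parityHom_jet, map_smul, superDer_jet, smul_smul, pow_add]
  | hm x y hx hy =>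
    simp only [superDer_mul, map_add, map_mul, hx, hy, comm, smul_add, smul_mul_assoc,
      mul_smul_comm]
  | ha x y hx hy => simp [hx, hy]

end superDer

/-- The iterated derivative `D^I = D_0^{I 0} D_1^{I 1} D_2^{I 2} D_3^{I 3}`. -/
def iterD {M : Type*} [AddCommMonoid M] [Module ℝ M] (D : Fin 4 → Module.End ℝ M)
    (I : Fin 4 → ℕ) : Module.End ℝ M :=
  (List.ofFn fun μ => D μ ^ I μ).prod

theorem iterD_comm {M : Type*} [AddCommMonoid M] [Module ℝ M] {D : Fin 4 → Module.End ℝ M}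
    {S : Module.End ℝ M} (h : ∀ μ, Commute S (D μ)) (I : Fin 4 → ℕ) :
    Commute S (iterD D I) := by
  apply Commute.list_prod_right
  intro y hy
  obtain ⟨μ, rfl⟩ := (List.mem_ofFn' _ _).mp hy
  exact (h μ).pow_right _

/-- The derivative `∂_μ` on the jet algebra: the even derivation with `∂_μ (∂_I φ) = ∂_{I+μ} φ`. -/
def jetD (μ : Fin 4) : JetAlg ι →ₗ[ℝ] JetAlg ι :=
  superDer 0 (fun u => jet (u.1, u.2 + Pi.single μ 1)) fun u => by
    rw [parityHom_jet, zero_add]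

theorem parityHom_jetD (μ : Fin 4) :
    Commute (parityHom (ι := ι)).toLinearMap (jetD μ : Module.End ℝ (JetAlg ι)) :=
  LinearMap.ext fun x => by
    simpa [jetD] using parityHom_superDer 0 _ _ x

theorem parityHom_iterD (I : Fin 4 → ℕ) (x : JetAlg ι) :
    parityHom (iterD jetD I x) = iterD jetD I (parityHom x) :=
  LinearMap.congr_fun (iterD_comm (parityHom_jetD (ι := ι)) I) x

/-- The (prolonged, evolutionary) super vector field of parity `p` with characteristic `q`:
the left superderivation with `φ ↦ q φ` that commutes with the derivatives, i.e.
`∂_I φ ↦ ∂_I (q φ)`. -/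
def evolutionary (p : ℕ) (q : FieldComp ι → JetAlg ι)
    (hq : ∀ φ, parityHom (q φ) = (-1 : ℝ) ^ (p + φ.parity) • q φ) :
    JetAlg ι →ₗ[ℝ] JetAlg ι :=
  superDer p (fun u => iterD jetD u.2 (q u.1)) fun u => by
    rw [parityHom_iterD, hq, map_smul]

/-- The field component `φ` itself, as an element of the jet algebra. -/
def fld (φ : FieldComp ι) : JetAlg ι := jet (φ, 0)

theorem parityHom_fld (φ : FieldComp ι) : parityHom (fld φ) = (-1 : ℝ) ^ φ.parity • fld φ :=
  parityHom_jet _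

/-- The bracket `[X, Y]^a = f^a_{bc} X^b Y^c`. -/
def bracket [Fintype ι] (f : ι → ι → ι → ℝ) {B : Type*} [Ring B] [Algebra ℝ B]
    (X Y : ι → B) (a : ι) : B :=
  ∑ b, ∑ c, f a b c • (X b * Y c)

theorem map_bracket [Fintype ι] (f : ι → ι → ι → ℝ) {B B' : Type*} [Ring B] [Algebra ℝ B]
    [Ring B'] [Algebra ℝ B'] (h : B →ₐ[ℝ] B') (X Y : ι → B) (a : ι) :
    h (bracket f X Y a) = bracket f (fun b => h (X b)) (fun b => h (Y b)) a := by
  simp [bracket]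

theorem bracket_smul [Fintype ι] (f : ι → ι → ι → ℝ) {B : Type*} [Ring B] [Algebra ℝ B]
    (r s : ℝ) (X Y : ι → B) (a : ι) :
    bracket f (fun b => r • X b) (fun b => s • Y b) a = (r * s) • bracket f X Y a := by
  simp only [bracket, smul_mul_smul_comm, Finset.smul_sum]
  refine Finset.sum_congr rfl fun b _ => Finset.sum_congr rfl fun c _ => ?_
  rw [smul_comm]

theorem parityHom_bracket_fld [Fintype ι] (f : ι → ι → ι → ℝ) (X Y : ι → FieldComp ι)
    (k l : ℕ) (hX : ∀ b, (X b).parity = k) (hY : ∀ b, (Y b).parity = l) (a : ι) :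
    parityHom (bracket f (fun b => fld (X b)) (fun b => fld (Y b)) a) =
      (-1 : ℝ) ^ (k + l) • bracket f (fun b => fld (X b)) (fun b => fld (Y b)) a := by
  rw [map_bracket]
  simp only [parityHom_fld, hX, hY]
  rw [bracket_smul, pow_add]

/-! ## The gauge BRST and anti-BRST operators -/

open FieldComp

theorem parityHom_jetD_fld (μ : Fin 4) (φ : FieldComp ι) :
    parityHom (jetD μ (fld φ)) = (-1 : ℝ) ^ φ.parity • jetD μ (fld φ) := by
  have := LinearMap.congr_fun (parityHom_jetD (ι := ι) μ) (fld φ)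
  simpa [parityHom_fld] using this

section BRST

variable [Fintype ι] (f : ι → ι → ι → ℝ) (gc ξ : ℝ)

/-- The characteristic of the gauge BRST operator (coupling constant `gc`, gauge parameter `ξ`):
`Q A^a_μ = ξ⁻¹ ∂_μ c^a + gc f^a_{bc} c^b A^c_μ`, `Q c^a = (gc/2) f^a_{bc} c^b c^c`,
`Q c̄^a = ξ⁻¹ b^a`, `Q b^a = 0`. -/
def brstChar : FieldComp ι → JetAlg ι
  | gaugeField μ a => (1 / ξ) • jetD μ (fld (ghost a)) +
      gc • bracket f (fun b => fld (ghost b)) (fun c => fld (gaugeField μ c)) a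
  | ghost a => (gc / 2) • bracket f (fun b => fld (ghost b)) (fun c => fld (ghost c)) a
  | antighost a => (1 / ξ) • fld (aux a)
  | aux _ => 0

/-- The characteristic of the gauge anti-BRST operator:
`Q̄ A^a_μ = ξ⁻¹ ∂_μ c̄^a + gc f^a_{bc} c̄^b A^c_μ`, `Q̄ c^a = -ξ⁻¹ b^a + gc f^a_{bc} c̄^b c^c`,
`Q̄ c̄^a = (gc/2) f^a_{bc} c̄^b c̄^c`, `Q̄ b^a = gc f^a_{bc} c̄^b b^c`. -/
def antiBrstChar : FieldComp ι → JetAlg ι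
  | gaugeField μ a => (1 / ξ) • jetD μ (fld (antighost a)) +
      gc • bracket f (fun b => fld (antighost b)) (fun c => fld (gaugeField μ c)) a
  | ghost a => -((1 / ξ) • fld (aux a)) +
      gc • bracket f (fun b => fld (antighost b)) (fun c => fld (ghost c)) a
  | antighost a =>
      (gc / 2) • bracket f (fun b => fld (antighost b)) (fun c => fld (antighost c)) a
  | aux a => gc • bracket f (fun b => fld (antighost b)) (fun c => fld (aux c)) a

theorem brstChar_parity (φ : FieldComp ι) :
    parityHom (brstChar f gc ξ φ) = (-1 : ℝ) ^ (1 + φ.parity) • brstChar f gc ξ φ := by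
  cases φ with
  | gaugeField μ a =>
    simp only [brstChar, map_add, map_smul, parityHom_jetD_fld,
      parityHom_bracket_fld f ghost (gaugeField μ) 1 0 (fun _ => rfl) (fun _ => rfl), parity]
    module
  | ghost a =>
    simp only [brstChar, map_smul,
      parityHom_bracket_fld f ghost ghost 1 1 (fun _ => rfl) (fun _ => rfl), parity]
    module
  | antighost a => simp only [brstChar, map_smul, parityHom_fld, parity]; module
  | aux a => simp [brstChar]

theorem antiBrstChar_parity (φ : FieldComp ι) :
    parityHom (antiBrstChar f gc ξ φ) = (-1 : ℝ) ^ (1 + φ.parity) • antiBrstChar f gc ξ φ := by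
  cases φ with
  | gaugeField μ a =>
    simp only [antiBrstChar, map_add, map_smul, parityHom_jetD_fld,
      parityHom_bracket_fld f antighost (gaugeField μ) 1 0 (fun _ => rfl) (fun _ => rfl), parity]
    module
  | ghost a =>
    simp only [antiBrstChar, map_add, map_neg, map_smul, parityHom_fld,
      parityHom_bracket_fld f antighost ghost 1 1 (fun _ => rfl) (fun _ => rfl), parity]
    module
  | antighost a =>
    simp only [antiBrstChar, map_smul,
      parityHom_bracket_fld f antighost antighost 1 1 (fun _ => rfl) (fun _ => rfl), parity]
    module
  | aux a =>
    simp only [antiBrstChar, map_smul,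
      parityHom_bracket_fld f antighost aux 1 0 (fun _ => rfl) (fun _ => rfl), parity]
    module

end BRST

end JetAlg

/-! ## Local densities over the chart `U` -/

/-- The algebra of local expressions on `U`: polynomials in the jets of the fields with smooth
functions on `U` as coefficients. A Lagrange density is identified with its coefficient with
respect to `dt ∧ dx ∧ dy ∧ dz`. -/
abbrev LocalAlg (U : TopologicalSpace.Opens Coord) (ι : Type*) : Type _ :=
  SmoothFun U ⊗[ℝ] JetAlg ι

instance (U : TopologicalSpace.Opens Coord) (ι : Type*) : Ring (LocalAlg U ι) :=
  Algebra.TensorProduct.instRing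

instance (U : TopologicalSpace.Opens Coord) (ι : Type*) : Algebra ℝ (LocalAlg U ι) :=
  Algebra.TensorProduct.instAlgebra

section LocalAlg

variable {U : TopologicalSpace.Opens Coord} {ι : Type*}

/-- A smooth function as a local expression. -/
def coeff (h : SmoothFun U) : LocalAlg U ι := h ⊗ₜ 1

/-- A field component as a local expression. -/
def field (φ : FieldComp ι) : LocalAlg U ι := 1 ⊗ₜ fld φ

/-- The total derivative `∂_μ` of local expressions. -/
def totalD (μ : Fin 4) : LocalAlg U ι →ₗ[ℝ] LocalAlg U ι :=
  (partialDeriv μ).rTensor (JetAlg ι) + (jetD μ).lTensor (SmoothFun U)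

/-- Equality of Lagrange densities up to a total divergence. -/
def EqModDiv (X Y : LocalAlg U ι) : Prop :=
  ∃ J : Fin 4 → LocalAlg U ι, X - Y = ∑ μ, totalD μ (J μ)

/-- The parity automorphism on local expressions. -/
def parityLoc : LocalAlg U ι →ₐ[ℝ] LocalAlg U ι :=
  Algebra.TensorProduct.map (AlgHom.id ℝ _) parityHom

/-- The even local expressions. -/
def evenPart (U : TopologicalSpace.Opens Coord) (ι : Type*) : Subalgebra ℝ (LocalAlg U ι) :=
  AlgHom.equalizer parityLoc (AlgHom.id ℝ _)

/-- The gauge BRST operator `Q` on local expressions: it annihilates the coefficient functions,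
in particular the metric. -/
def brst [Fintype ι] (f : ι → ι → ι → ℝ) (gc ξ : ℝ) : LocalAlg U ι →ₗ[ℝ] LocalAlg U ι :=
  (evolutionary 1 (brstChar f gc ξ) (brstChar_parity f gc ξ)).lTensor (SmoothFun U)

/-- The gauge anti-BRST operator `Q̄` on local expressions. -/
def antiBrst [Fintype ι] (f : ι → ι → ι → ℝ) (gc ξ : ℝ) : LocalAlg U ι →ₗ[ℝ] LocalAlg U ι :=
  (evolutionary 1 (antiBrstChar f gc ξ) (antiBrstChar_parity f gc ξ)).lTensor (SmoothFun U)

/-- The gauge super-BRST operator `𝒬 = Q ∘ Q̄`. -/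
def superBrst [Fintype ι] (f : ι → ι → ι → ℝ) (gc ξ : ℝ) : LocalAlg U ι →ₗ[ℝ] LocalAlg U ι :=
  brst f gc ξ ∘ₗ antiBrst f gc ξ

/-! ### Euler–Lagrange derivative and substitution for the auxiliary field -/

open Classical in
/-- The partial derivative with respect to the jet coordinate `∂_I b^a`. -/
def auxPartial (a : ι) (I : Fin 4 → ℕ) : LocalAlg U ι →ₗ[ℝ] LocalAlg U ι :=
  (superDer 0 (fun u => if u = (FieldComp.aux a, I) then 1 else 0) fun u => by
    split_ifs with h
    · subst h; simp [FieldComp.parity]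
    · simp).lTensor (SmoothFun U)

/-- The Euler–Lagrange derivative with respect to `b^a`,
`∑_I (-1)^{|I|} ∂_I (∂X / ∂(∂_I b^a))`; only finitely many summands are non-zero. -/
def eulerAux (a : ι) (X : LocalAlg U ι) : LocalAlg U ι :=
  ∑ᶠ I : Fin 4 → ℕ, (-1 : ℝ) ^ (∑ μ, I μ) • iterD totalD I (auxPartial a I X)

theorem parityLoc_totalD (μ : Fin 4) :
    Commute (parityLoc (U := U) (ι := ι)).toLinearMap
      (totalD μ : Module.End ℝ (LocalAlg U ι)) := by
  refine TensorProduct.ext' fun h x => ?_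
  have := LinearMap.congr_fun (parityHom_jetD (ι := ι) μ) x
  simp only [Module.End.mul_apply, AlgHom.toLinearMap_apply] at this
  simp [parityLoc, totalD, this]

theorem parityLoc_iterD (I : Fin 4 → ℕ) (x : LocalAlg U ι) :
    parityLoc (iterD totalD I x) = iterD totalD I (parityLoc x) :=
  LinearMap.congr_fun (iterD_comm (parityLoc_totalD (U := U) (ι := ι)) I) x

theorem coeff_commute (h : SmoothFun U) (y : LocalAlg U ι) : Commute (coeff h) y := by
  induction y using TensorProduct.induction_on with
  | zero => exact Commute.zero_right _
  | tmul k z => simp [coeff, Commute, SemiconjBy, mul_comm]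
  | add y z hy hz => exact hy.add_right hz

theorem even_commute {x : LocalAlg U ι} (hx : parityLoc x = x) (y : LocalAlg U ι) :
    Commute x y := by
  have swap : ∀ (u : Jet ι) (z : LocalAlg U ι),
      (1 ⊗ₜ jet u : LocalAlg U ι) * z = (parityLoc ^ u.1.parity) z * (1 ⊗ₜ jet u) := by
    intro u z
    have hp : ∀ (p : ℕ) (h : SmoothFun U) (w : JetAlg ι),
        (parityLoc ^ p) (h ⊗ₜ[ℝ] w) = h ⊗ₜ (parityHom ^ p) w := by
      intro p h w
      induction p with
      | zero => simp
      | succ n ih => rw [pow_succ', AlgHom.mul_apply, ih, pow_succ', AlgHom.mul_apply]; rfl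
    induction z using TensorProduct.induction_on with
    | zero => simp
    | tmul h w => rw [hp]; simp [jet_mul u w]
    | add y z hy hz => rw [mul_add, hy, hz, map_add, add_mul]
  have hpow : ∀ p : ℕ, (parityLoc ^ p) x = x := by
    intro p
    induction p with
    | zero => simp
    | succ n ih => rw [pow_succ', AlgHom.mul_apply, ih, hx]
  have hj : ∀ w : JetAlg ι, Commute x (1 ⊗ₜ w : LocalAlg U ι) := by
    intro w
    induction w using jet_induction with
    | hc r =>
      have : (1 ⊗ₜ algebraMap ℝ (JetAlg ι) r : LocalAlg U ι) = algebraMap ℝ _ r := by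
        rw [Algebra.TensorProduct.algebraMap_apply, Algebra.algebraMap_eq_smul_one,
          Algebra.algebraMap_eq_smul_one, TensorProduct.tmul_smul, TensorProduct.smul_tmul']
      rw [this]
      exact (Algebra.commutes r x).symm
    | hj u =>
      have := swap u x
      rw [hpow] at this
      exact this.symm
    | hm w z hw hz =>
      have : (1 ⊗ₜ (w * z) : LocalAlg U ι) = (1 ⊗ₜ w) * (1 ⊗ₜ z) := by simp
      rw [this]
      exact hw.mul_right hz
    | ha w z hw hz =>
      rw [TensorProduct.tmul_add]
      exact hw.add_right hz
  induction y using TensorProduct.induction_on with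
  | zero => exact Commute.zero_right _
  | tmul h w =>
    have : (h ⊗ₜ w : LocalAlg U ι) = coeff h * (1 ⊗ₜ w) := by simp [coeff]
    rw [this]
    exact (coeff_commute h x).symm.mul_right (hj w)
  | add y z hy hz => exact hy.add_right hz

/-- The value on jet coordinates of the substitution `b^a ↦ β^a`. -/
def substVal (β : ι → evenPart U ι) : Jet ι → LocalAlg U ι
  | (FieldComp.aux a, I) => iterD totalD I (β a : LocalAlg U ι)
  | (FieldComp.gaugeField μ a, I) => 1 ⊗ₜ jet (FieldComp.gaugeField μ a, I)
  | (FieldComp.ghost a, I) => 1 ⊗ₜ jet (FieldComp.ghost a, I)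
  | (FieldComp.antighost a, I) => 1 ⊗ₜ jet (FieldComp.antighost a, I)

theorem substVal_mul (β : ι → evenPart U ι) (s t : Jet ι) :
    substVal β s * substVal β t =
      (-1 : ℝ) ^ (s.1.parity * t.1.parity) • (substVal β t * substVal β s) := by
  have hβ : ∀ a I, parityLoc (iterD totalD I (β a : LocalAlg U ι)) =
      iterD totalD I (β a : LocalAlg U ι) := fun a I => by
    rw [parityLoc_iterD, show parityLoc (β a : LocalAlg U ι) = β a from (β a).2]
  have hj : ∀ s t : Jet ι, (1 ⊗ₜ jet s : LocalAlg U ι) * (1 ⊗ₜ jet t) =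
      (-1 : ℝ) ^ (s.1.parity * t.1.parity) • ((1 ⊗ₜ jet t) * (1 ⊗ₜ jet s)) := fun s t => by
    rw [Algebra.TensorProduct.tmul_mul_tmul, jet_mul_jet, Algebra.TensorProduct.tmul_mul_tmul,
      TensorProduct.tmul_smul]
  obtain ⟨φ, I⟩ := s
  obtain ⟨ψ, K⟩ := t
  cases φ <;> cases ψ <;>
    first
    | exact hj _ _
    | (simp only [FieldComp.parity, mul_zero, zero_mul, pow_zero, one_smul, substVal]
       first
       | exact (even_commute (hβ _ _) _).eq
       | exact (even_commute (hβ _ _) _).eq.symm)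

/-- Substitution of even local expressions `β^a` for the auxiliary field: the homomorphism over
the smooth functions with `∂_I b^a ↦ ∂_I β^a` that fixes the jets of the other fields. -/
def substAux (β : ι → evenPart U ι) : LocalAlg U ι →ₐ[ℝ] LocalAlg U ι :=
  Algebra.TensorProduct.lift Algebra.TensorProduct.includeLeft
    (jetLift (substVal β) (substVal_mul β)) fun h x => by
      rw [Algebra.TensorProduct.includeLeft_apply]
      exact coeff_commute h (jetLift (substVal β) (substVal_mul β) x)

theorem substAux_tmul_jet (β : ι → evenPart U ι) (h : SmoothFun U) (u : Jet ι) :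
    substAux β (h ⊗ₜ jet u) = coeff h * substVal β u := by
  rw [substAux, Algebra.TensorProduct.lift_tmul, jetLift_jet,
    Algebra.TensorProduct.includeLeft_apply, coeff]

/-! ### The gauge fixing boson and the Lagrange densities -/

section Densities

variable [Fintype ι] (m : LorentzMetric U) (f : ι → ι → ι → ℝ) (gc ξ : ℝ)

/-- the gauge field `A^a_μ` -/
def A (U : TopologicalSpace.Opens Coord) (μ : Fin 4) (a : ι) : LocalAlg U ι :=
  field (.gaugeField μ a)

/-- the ghost `c^a` -/
def gh (U : TopologicalSpace.Opens Coord) (a : ι) : LocalAlg U ι := field (.ghost a)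

/-- the antighost `c̄^a` (colour indices are raised and lowered with `δ_{ab}`) -/
def agh (U : TopologicalSpace.Opens Coord) (a : ι) : LocalAlg U ι := field (.antighost a)

/-- the auxiliary field `b^a` -/
def auxB (U : TopologicalSpace.Opens Coord) (a : ι) : LocalAlg U ι := field (.aux a)

/-- The gauge fixing boson `G = -(ξ/2) (δ_{ab} g^{μν} A^a_μ A^b_ν - c̄_a c^a) dV_g`. -/
def gaugeFixingBoson : LocalAlg U ι :=
  coeff m.vol * (-(ξ / 2)) • ((∑ μ, ∑ ν, ∑ a, coeff (m.inv μ ν) * (A U μ a * A U ν a))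
    - ∑ a, agh U a * gh U a)

/-- The covariant Lorenz gauge fixing functional
`L^a = gc g^{μν} ∇_μ A^a_ν` with `∇_μ A_ν = ∂_μ A_ν - Γ^ρ_{μν} A_ρ`. -/
def lorenz (a : ι) : LocalAlg U ι :=
  gc • ∑ μ, ∑ ν, coeff (m.inv μ ν) *
    (totalD μ (A U ν a) - ∑ ρ, coeff (m.christoffel ρ μ ν) * A U ρ a)

/-- `f^a_{bc} f_{ade} c̄^b c̄^c c^d c^e`. -/
def fourGhost : LocalAlg U ι :=
  ∑ a, ∑ b, ∑ c, ∑ d, ∑ e, (f a b c * f a d e) • (agh U b * agh U c * gh U d * gh U e)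

/-- The density `𝒬 G` with the auxiliary field:
`( (1/2ξ) b_a b^a + (1/(gc ξ)) b_a L^a + (1/ξ) g^{μν} (∂_μ c̄_a)(∂_ν c^a)
+ gc g^{μν} f^a_{bc} (∂_μ c̄_a) c^b A^c_ν - (gc/2) f^a_{bc} b_a c̄^b c^c
- (gc² ξ/8) f^a_{bc} f_{ade} c̄^b c̄^c c^d c^e ) dV_g`. -/
def auxDensity : LocalAlg U ι :=
  coeff m.vol *
    ((1 / (2 * ξ)) • (∑ a, auxB U a * auxB U a)
      + (1 / (gc * ξ)) • (∑ a, auxB U a * lorenz m gc a)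
      + (1 / ξ) • (∑ μ, ∑ ν, ∑ a, coeff (m.inv μ ν) * (totalD μ (agh U a) * totalD ν (gh U a)))
      + gc • (∑ μ, ∑ ν, ∑ a, ∑ b, ∑ c,
          f a b c • (coeff (m.inv μ ν) * (totalD μ (agh U a) * gh U b * A U ν c)))
      - (gc / 2) • (∑ a, ∑ b, ∑ c, f a b c • (auxB U a * agh U b * gh U c))
      - (gc ^ 2 * ξ / 8) • fourGhost f)

/-- The symmetric gauge fixing and ghost density:
`(1/ξ) ( -(1/(2 gc²)) δ_{ab} L^a L^b + g^{μν} (∂_μ c̄_a)(∂_ν c^a) ) dV_g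
+ (gc/2) g^{μν} f^a_{bc} ( (∂_μ c̄_a) c^b A^c_ν - c̄_a (∂_μ c^b) A^c_ν ) dV_g
- (gc² ξ/16) f^a_{bc} f_{ade} c̄^b c̄^c c^d c^e dV_g`. -/
def symmetricDensity : LocalAlg U ι :=
  coeff m.vol *
    ((1 / ξ) • (-((1 / (2 * gc ^ 2)) • ∑ a, lorenz m gc a * lorenz m gc a)
        + ∑ μ, ∑ ν, ∑ a, coeff (m.inv μ ν) * (totalD μ (agh U a) * totalD ν (gh U a)))
      + (gc / 2) • (∑ μ, ∑ ν, ∑ a, ∑ b, ∑ c, f a b c • (coeff (m.inv μ ν) *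
          (totalD μ (agh U a) * gh U b * A U ν c - agh U a * totalD μ (gh U b) * A U ν c)))
      - (gc ^ 2 * ξ / 16) • fourGhost f)

/-- The shifted auxiliary field `b'^a = b^a - (gc ξ/2) f^a_{bc} c̄^b c^c`. -/
def shiftedAux (a : ι) : LocalAlg U ι :=
  auxB U a - (gc * ξ / 2) • bracket f (agh U) (gh U) a

theorem shift_even (a : ι) :
    auxB U a + (gc * ξ / 2) • bracket f (agh U) (gh U) a ∈ evenPart U ι := by
  have h1 : ∀ φ : FieldComp ι, parityLoc (field φ : LocalAlg U ι) =
      (-1 : ℝ) ^ φ.parity • field φ := fun φ => by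
    simp [parityLoc, field, parityHom_fld, TensorProduct.tmul_smul]
  change parityLoc _ = _
  rw [map_add, map_smul, map_bracket]
  simp only [auxB, agh, gh, h1, FieldComp.parity, pow_zero, one_smul, pow_one]
  rw [bracket_smul]
  simp
  rfl

/-- The change of variables from `b` to the shifted auxiliary field,
`b^a = b'^a + (gc ξ/2) f^a_{bc} c̄^b c^c`: in its values the generator `b^a` stands for `b'^a`. -/
def shift : LocalAlg U ι →ₐ[ℝ] LocalAlg U ι :=
  substAux fun a => ⟨auxB U a + (gc * ξ / 2) • bracket f (agh U) (gh U) a, shift_even f gc ξ a⟩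

end Densities

end LocalAlg

/-! ## The gauge Lie algebra -/

section Lie

variable {𝔤 : Type*} [LieRing 𝔤] [LieAlgebra ℝ 𝔤] {ι : Type*} (T : Module.Basis ι ℝ 𝔤)

/-- The structure constants `f^a_{bc}` of the basis `T`: `[T_b, T_c] = f^a_{bc} T_a`. -/
def structureConst (a b c : ι) : ℝ := T.repr ⁅T b, T c⁆ a

/-- The colour metric `δ_{ab}`, for which the basis `T` is orthonormal. -/
def colorMetric [Fintype ι] (x y : 𝔤) : ℝ := ∑ a, T.repr x a * T.repr y a

end Lie

end QYM

end

open scoped ContDiff TensorProduct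

noncomputable section

namespace QYM

/-! ### Calculus of smooth coefficient functions. -/

section Coefficients

variable {U : TopologicalSpace.Opens Coord}

/-! Three mechanisms carry the result. First, `𝒬G` is computed exactly, with no divergence dropped.
In `Q̄(A²)` the non-derivative terms cancel by total antisymmetry of `f`, so `Q̄G` contains only
`A·∂c̄`, `c̄·b` and `[c̄,c̄]·c`. Applying `Q` yields the stated density, except that `-(1/ξ) A·∂b`
stands in place of `(1/(gc ξ)) b·L` (`antiBrst_gaugeFixingBoson`, `superBrst_gaugeFixingBoson`).

Second, `√(-det g) g^{μν} A_μ` has total divergence `√(-det g) g^{μν} ∇_μ A_ν`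
(`sum_totalD_vol_mul`). This follows from Jacobi's formula and the derivative of the inverse metric
(`sum_partialDeriv_vol_mul_inv`). Integration by parts then trades `A·∂β` for `-(1/gc) β·L` for any
`β` (`gaugeDeriv_eqModDiv`). With `β = b` this is the first claim.

Third, the shift of `b` by `(gc ξ/2)[c̄,c]` completes the square (`superBrstDensity_shift`). The
terms linear in `b'` without derivatives cancel. The piece `A·∂[c̄,c]` makes the vertex symmetric
between ghost and antighost. The leftover `[c̄,c]²` equals `-[c̄,c̄]·[c,c]/2` by the Jacobi identity
for odd elements (`sum_bracket_mul_bracket`), which turns the coefficient `1/8` of the four-ghost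
term into `1/16`.

The shifted density depends on `b'` only through `b'²/(2ξ) - (1/ξ) A·∂b'`, so its Euler–Lagrange
expression is `(1/ξ)√(-det g)(b' + L/gc)`. Both prefactors are invertible, whence uniqueness. A
second integration by parts, with `β = -L/gc`, gives the symmetric density. -/

theorem partialDeriv_mul (μ : Fin 4) (a b : SmoothFun U) :
    partialDeriv μ (a * b) = partialDeriv μ a * b + a * partialDeriv μ b := by
  ext x
  have : fderiv ℝ (extendZero (a * b).1) x =
      fderiv ℝ (fun y => extendZero a.1 y * extendZero b.1 y) x :=
    fderiv_extendZero_congr (fun x => by simp [extendZero_apply]) x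
  change fderiv ℝ (extendZero (a * b).1) x (Pi.single μ 1) =
    fderiv ℝ (extendZero a.1) x (Pi.single μ 1) * b.1 x +
      a.1 x * fderiv ℝ (extendZero b.1) x (Pi.single μ 1)
  rw [this, fderiv_fun_mul (SmoothFun.differentiableAt a x) (SmoothFun.differentiableAt b x)]
  simp [extendZero_apply]
  ring

/-- The coordinate derivative `∂_μ` as a derivation of the algebra of smooth functions. -/
def partialDerivation (μ : Fin 4) : Derivation ℝ (SmoothFun U) (SmoothFun U) :=
  Derivation.mk' (partialDeriv μ) fun a b => by
    rw [partialDeriv_mul, smul_eq_mul, smul_eq_mul]; ring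

theorem partialDerivation_apply (μ : Fin 4) (a : SmoothFun U) :
    partialDerivation μ a = partialDeriv μ a := rfl

theorem SmoothFun.isUnit_of_ne_zero (h : SmoothFun U) (h0 : ∀ x : U, (h : U → ℝ) x ≠ 0) :
    IsUnit h := by
  refine IsUnit.of_mul_eq_one
    ⟨fun x => ((h : U → ℝ) x)⁻¹,
    contDiffOn_extendZero (F := fun x => (extendZero h.1 x)⁻¹) (h.2.inv fun x hx => ?_)
      fun x => by rw [extendZero_apply]⟩ ?_
  · rw [extendZero_apply h.1 ⟨x, hx⟩]
    exact h0 _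
  · ext x
    exact mul_inv_cancel₀ (h0 x)

end Coefficients

/-! ### Derivations of products and determinants. -/

theorem derivation_prod {R A n : Type*} [CommRing R] [CommRing A] [Algebra R A] [DecidableEq n]
    (D : Derivation R A A) (s : Finset n) (g : n → A) :
    D (∏ i ∈ s, g i) = ∑ i ∈ s, (∏ j ∈ s.erase i, g j) * D (g i) := by
  induction s using Finset.induction_on with
  | empty => simp
  | insert a s ha ih =>
    rw [Finset.prod_insert ha, Derivation.leibniz, ih, Finset.sum_insert ha,
      Finset.erase_insert ha, smul_eq_mul, smul_eq_mul, Finset.mul_sum, add_comm]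
    congr 1
    refine Finset.sum_congr rfl fun i hi => ?_
    have hia : a ≠ i := fun h => ha (h ▸ hi)
    rw [Finset.erase_insert_of_ne hia, Finset.prod_insert (by simp [ha]), mul_assoc]

/-- Jacobi's formula for a derivation of a commutative ring. -/
theorem derivation_det {R A n : Type*} [CommRing R] [CommRing A] [Algebra R A]
    [Fintype n] [DecidableEq n] (D : Derivation R A A) (M : Matrix n n A) :
    D M.det = (M.adjugate * M.map D).trace := by
  -- Cramer's rule: the trace becomes a sum of determinants, each with one column differentiated.
  -- This is the product rule applied to the permutation expansion.
  have h1 : ∀ i, (M.adjugate * M.map D) i i = (M.updateCol i fun j => D (M j i)).det := by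
    intro i
    rw [← Matrix.cramer_apply, Matrix.cramer_eq_adjugate_mulVec]
    rfl
  simp only [Matrix.trace, Matrix.diag, h1]
  simp only [Matrix.det_apply, map_sum]
  rw [Finset.sum_comm]
  refine Finset.sum_congr rfl fun σ _ => ?_
  rw [← Finset.smul_sum]
  have h2 : ∀ z : ℤˣ, ∀ a : A, D (z • a) = z • D a := fun z a => by
    rw [Units.smul_def, Units.smul_def, map_zsmul]
  rw [h2, derivation_prod]
  congr 1
  refine Finset.sum_congr rfl fun i _ => ?_
  rw [← Finset.mul_prod_erase _ _ (Finset.mem_univ i), mul_comm]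
  congr 1
  · simp
  · refine Finset.prod_congr rfl fun j hj => ?_
    rw [Matrix.updateCol_ne (Finset.ne_of_mem_erase hj)]

/-! ### Derivatives of the volume factor and of the inverse metric. -/

namespace LorentzMetric

variable {U : TopologicalSpace.Opens Coord} (m : LorentzMetric U)

theorem isUnit_det : IsUnit m.comp.det :=
  SmoothFun.isUnit_of_ne_zero _ fun x => (m.det_neg x).ne

theorem isUnit_vol : IsUnit m.vol :=
  SmoothFun.isUnit_of_ne_zero _ fun x =>
    (Real.sqrt_pos.mpr (neg_pos.mpr (m.det_neg x))).ne'

theorem vol_mul_vol : m.vol * m.vol = -m.comp.det := by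
  ext x
  exact Real.mul_self_sqrt (neg_pos.mpr (m.det_neg x)).le

theorem inv_symm (μ ν : Fin 4) : m.inv μ ν = m.inv ν μ := by
  have : (m.comp⁻¹).transpose = m.comp⁻¹ := by
    rw [Matrix.transpose_nonsing_inv, m.symm.eq]
  exact (congrFun (congrFun this ν) μ)

theorem comp_symm (μ ν : Fin 4) : m.comp μ ν = m.comp ν μ :=
  m.symm.apply ν μ

/-- Differentiating `vol² + det g = 0` avoids differentiating the square root. Jacobi's formula
handles the determinant, and the unit `vol` is cancelled. -/
theorem partialDeriv_vol (μ : Fin 4) :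
    (2 : ℝ) • partialDeriv μ m.vol =
      m.vol * ∑ ρ, ∑ σ, m.inv ρ σ * partialDeriv μ (m.comp σ ρ) := by
  have h2 : m.comp.adjugate = m.comp.det • m.comp⁻¹ := by
    rw [Matrix.inv_def, smul_smul, Ring.mul_inverse_cancel _ m.isUnit_det, one_smul]
  have h0 : m.vol * m.vol + m.comp.det = 0 := by rw [vol_mul_vol]; ring
  have h := congrArg (partialDerivation μ) h0
  rw [map_add, map_zero, derivation_det, Derivation.leibniz, h2, Matrix.smul_mul,
    Matrix.trace_smul, smul_eq_mul, smul_eq_mul, partialDerivation_apply] at h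
  have h3 : (m.comp⁻¹ * m.comp.map (partialDerivation μ)).trace =
      ∑ ρ, ∑ σ, m.inv ρ σ * partialDeriv μ (m.comp σ ρ) := rfl
  rw [h3] at h
  refine m.isUnit_vol.mul_left_cancel ?_
  rw [two_smul]
  linear_combination h - (∑ ρ, ∑ σ, m.inv ρ σ * partialDeriv μ (m.comp σ ρ)) * h0

/-- Obtained by differentiating `g⁻¹ g = 1` and multiplying by `g⁻¹` on the right. -/
theorem partialDeriv_inv (μ ρ σ : Fin 4) :
    partialDeriv μ (m.inv ρ σ) =
      -∑ α, ∑ β, m.inv ρ α * partialDeriv μ (m.comp α β) * m.inv β σ := by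
  have h1 : m.comp⁻¹ * m.comp = 1 := Matrix.nonsing_inv_mul _ m.isUnit_det
  have h2 : m.comp * m.comp⁻¹ = 1 := Matrix.mul_nonsing_inv _ m.isUnit_det
  have hD : ∀ M N : Matrix (Fin 4) (Fin 4) (SmoothFun U),
      (M * N).map (partialDerivation μ) =
        M.map (partialDerivation μ) * N + M * N.map (partialDerivation μ) := by
    intro M N
    ext1 i j
    simp only [Matrix.map_apply, Matrix.mul_apply, Matrix.add_apply, map_sum, Derivation.leibniz,
      smul_eq_mul, ← Finset.sum_add_distrib]
    exact Finset.sum_congr rfl fun k _ => by ring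
  have h3 := hD m.comp⁻¹ m.comp
  have h4 : (1 : Matrix (Fin 4) (Fin 4) (SmoothFun U)).map (partialDerivation μ) = 0 := by
    ext1 i j
    by_cases h : i = j <;> simp [h]
  rw [h1, h4] at h3
  have h5 : m.comp⁻¹.map (partialDerivation μ) =
      -(m.comp⁻¹ * m.comp.map (partialDerivation μ) * m.comp⁻¹) := by
    have := congrArg (· * m.comp⁻¹) h3
    simp only [zero_mul, add_mul, mul_assoc, h2, mul_one] at this
    rw [mul_assoc]
    exact eq_neg_of_add_eq_zero_left this.symm
  have h6 := congrFun (congrFun h5 ρ) σ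
  simp only [Matrix.map_apply, Matrix.neg_apply, Matrix.mul_apply, Finset.sum_mul] at h6
  rw [Finset.sum_comm] at h6
  exact h6

/-- `∂_μ (√(-det g) g^{μρ}) = -√(-det g) g^{μν} Γ^ρ_{μν}`. -/
theorem sum_partialDeriv_vol_mul_inv (ρ : Fin 4) :
    ∑ μ, partialDeriv μ (m.vol * m.inv μ ρ) =
      -(m.vol * ∑ μ, ∑ ν, m.inv μ ν * m.christoffel ρ μ ν) := by
  -- Doubling both sides clears the factor `1/2` of the Christoffel symbols and matches the form of
  -- `partialDeriv_vol`.
  have hinj : Function.Injective fun x : SmoothFun U => (2 : ℝ) • x :=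
    smul_right_injective _ two_ne_zero
  apply hinj
  have e1 : ∀ μ, (2 : ℝ) • partialDeriv μ (m.vol * m.inv μ ρ) =
      m.vol * (∑ α, ∑ β, m.inv α β * partialDeriv μ (m.comp β α) * m.inv μ ρ)
      - 2 * (m.vol * ∑ α, ∑ β, m.inv μ α * partialDeriv μ (m.comp α β) * m.inv β ρ) := by
    intro μ
    rw [partialDeriv_mul, smul_add, ← smul_mul_assoc, partialDeriv_vol, partialDeriv_inv]
    simp only [Finset.sum_mul, mul_assoc]
    rw [two_smul]
    ring
  have e2 : ∀ μ ν, (2 : ℝ) • (m.inv μ ν * m.christoffel ρ μ ν) =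
      ∑ σ, (m.inv μ ν * m.inv ρ σ * partialDeriv μ (m.comp σ ν)
        + m.inv μ ν * m.inv ρ σ * partialDeriv ν (m.comp σ μ)
        - m.inv μ ν * m.inv ρ σ * partialDeriv σ (m.comp μ ν)) := by
    intro μ ν
    rw [christoffel, mul_smul_comm, smul_smul]
    rw [mul_one_div_cancel two_ne_zero, one_smul, Finset.mul_sum]
    exact Finset.sum_congr rfl fun σ _ => by ring
  simp only [smul_neg, ← mul_smul_comm, Finset.smul_sum, e1, e2]
  simp only [← Finset.mul_sum, Finset.sum_sub_distrib, Finset.sum_add_distrib]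
  -- By symmetry of the metric only two contractions occur: `P = g^{μν} g^{ρσ} ∂_σ g_{μν}` and `R =
  -- g^{μν} g^{ρσ} ∂_μ g_{σν}`. Both sides reduce to `vol (P - 2R)`.
  have s1 : ∑ μ, ∑ α, ∑ β, m.inv α β * partialDeriv μ (m.comp β α) * m.inv μ ρ =
      ∑ μ, ∑ ν, ∑ σ, m.inv μ ν * m.inv ρ σ * partialDeriv σ (m.comp μ ν) := by
    rw [Finset.sum_comm]
    refine Finset.sum_congr rfl fun a _ => ?_
    rw [Finset.sum_comm]
    refine Finset.sum_congr rfl fun b _ => Finset.sum_congr rfl fun c _ => ?_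
    rw [m.comp_symm b a, m.inv_symm c ρ]; ring
  have s2 : ∑ μ, ∑ α, ∑ β, m.inv μ α * partialDeriv μ (m.comp α β) * m.inv β ρ =
      ∑ μ, ∑ ν, ∑ σ, m.inv μ ν * m.inv ρ σ * partialDeriv μ (m.comp σ ν) := by
    refine Finset.sum_congr rfl fun a _ => Finset.sum_congr rfl fun b _ =>
      Finset.sum_congr rfl fun c _ => ?_
    rw [m.comp_symm b c, m.inv_symm c ρ]; ring
  have s3 : ∑ μ, ∑ ν, ∑ σ, m.inv μ ν * m.inv ρ σ * partialDeriv ν (m.comp σ μ) =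
      ∑ μ, ∑ ν, ∑ σ, m.inv μ ν * m.inv ρ σ * partialDeriv μ (m.comp σ ν) := by
    rw [Finset.sum_comm]
    refine Finset.sum_congr rfl fun a _ => Finset.sum_congr rfl fun b _ =>
      Finset.sum_congr rfl fun c _ => ?_
    rw [m.inv_symm a b]
  rw [s1, s2, s3]
  ring

end LorentzMetric

/-! ### Leibniz rules on the algebra of local expressions. -/

section LocalAlg

variable {U : TopologicalSpace.Opens Coord} {ι : Type*}

theorem parityLoc_pow_tmul (p : ℕ) (h : SmoothFun U) (w : JetAlg ι) :
    (parityLoc ^ p) (h ⊗ₜ[ℝ] w) = h ⊗ₜ (parityHom ^ p) w := by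
  induction p with
  | zero => simp
  | succ n ih => rw [pow_succ', AlgHom.mul_apply, ih, pow_succ', AlgHom.mul_apply]; rfl

/-- Coefficient functions are even and untouched by the superderivation, so the graded Leibniz rule
passes from pure tensors to all local expressions. It serves `Q`, `Q̄`, the jet part of the total
derivative and the partial derivatives in `b` alike. -/
theorem superDer_lTensor_mul (p : ℕ) (v : Jet ι → JetAlg ι)
    (hv : ∀ u, parityHom (v u) = (-1 : ℝ) ^ (p + u.1.parity) • v u) (x y : LocalAlg U ι) :
    (superDer p v hv).lTensor (SmoothFun U) (x * y) =
      (superDer p v hv).lTensor (SmoothFun U) x * y +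
        (parityLoc ^ p) x * (superDer p v hv).lTensor (SmoothFun U) y := by
  induction x using TensorProduct.induction_on with
  | zero => simp
  | add x z hx hz => simp only [add_mul, map_add, hx, hz]; abel
  | tmul h w =>
    induction y using TensorProduct.induction_on with
    | zero => simp
    | add x z hx hz => simp only [mul_add, map_add, hx, hz]; abel
    | tmul k z =>
      simp only [Algebra.TensorProduct.tmul_mul_tmul, LinearMap.lTensor_tmul, superDer_mul,
        parityLoc_pow_tmul, TensorProduct.tmul_add]

theorem superDer_lTensor_coeff (p : ℕ) (v : Jet ι → JetAlg ι)
    (hv : ∀ u, parityHom (v u) = (-1 : ℝ) ^ (p + u.1.parity) • v u) (h : SmoothFun U) :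
    (superDer p v hv).lTensor (SmoothFun U) (coeff h) = 0 := by
  have := superDer_algebraMap p v hv 1
  rw [map_one] at this
  rw [coeff, LinearMap.lTensor_tmul, this, TensorProduct.tmul_zero]

theorem parityLoc_coeff (h : SmoothFun U) : parityLoc (coeff h : LocalAlg U ι) = coeff h := by
  simp [parityLoc, coeff]

theorem coeff_mul (h k : SmoothFun U) : (coeff (h * k) : LocalAlg U ι) = coeff h * coeff k := by
  simp [coeff]

theorem coeff_neg (h : SmoothFun U) : (coeff (-h) : LocalAlg U ι) = -coeff h :=
  TensorProduct.neg_tmul _ _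

theorem coeff_sum {α : Type*} (s : Finset α) (h : α → SmoothFun U) :
    (coeff (∑ i ∈ s, h i) : LocalAlg U ι) = ∑ i ∈ s, coeff (h i) :=
  TensorProduct.sum_tmul _ _ _

theorem isUnit_coeff {h : SmoothFun U} (hh : IsUnit h) : IsUnit (coeff h : LocalAlg U ι) :=
  hh.map (Algebra.TensorProduct.includeLeft : SmoothFun U →ₐ[ℝ] LocalAlg U ι)

theorem superDer_lTensor_coeff_mul (p : ℕ) (v : Jet ι → JetAlg ι)
    (hv : ∀ u, parityHom (v u) = (-1 : ℝ) ^ (p + u.1.parity) • v u) (h : SmoothFun U)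
    (x : LocalAlg U ι) :
    (superDer p v hv).lTensor (SmoothFun U) (coeff h * x) =
      coeff h * (superDer p v hv).lTensor (SmoothFun U) x := by
  rw [superDer_lTensor_mul, superDer_lTensor_coeff, zero_mul, zero_add]
  congr 1
  rw [coeff, parityLoc_pow_tmul, map_one]

/-- The total derivative is the sum of an operator on the coefficients and one on the jets, each of
which is an even derivation. -/
theorem totalD_mul (μ : Fin 4) (x y : LocalAlg U ι) :
    totalD μ (x * y) = totalD μ x * y + x * totalD μ y := by
  have h := superDer_lTensor_mul (U := U) 0 (fun u : Jet ι => jet (u.1, u.2 + Pi.single μ 1))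
    (fun u => by rw [parityHom_jet, zero_add]) x y
  have h' : (partialDeriv μ).rTensor (JetAlg ι) (x * y) =
      (partialDeriv μ).rTensor (JetAlg ι) x * y + x * (partialDeriv μ).rTensor (JetAlg ι) y := by
    clear h
    induction x using TensorProduct.induction_on with
    | zero => simp
    | add x z hx hz => simp only [add_mul, map_add, hx, hz]; abel
    | tmul h w =>
      induction y using TensorProduct.induction_on with
      | zero => simp
      | add x z hx hz => simp only [mul_add, map_add, hx, hz]; abel
      | tmul k z =>
        simp only [Algebra.TensorProduct.tmul_mul_tmul, LinearMap.rTensor_tmul,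
          partialDeriv_mul, TensorProduct.add_tmul]
  simp only [totalD, LinearMap.add_apply, h', jetD, h, pow_zero, AlgHom.one_apply]
  noncomm_ring

theorem totalD_coeff (μ : Fin 4) (h : SmoothFun U) :
    totalD μ (coeff h : LocalAlg U ι) = coeff (partialDeriv μ h) := by
  have := superDer_lTensor_coeff (U := U) 0 (fun u : Jet ι => jet (u.1, u.2 + Pi.single μ 1))
    (fun u => by rw [parityHom_jet, zero_add]) h
  simp only [totalD, LinearMap.add_apply, jetD, this, add_zero]
  rfl

theorem iterD_zero {M : Type*} [AddCommMonoid M] [Module ℝ M] (D : Fin 4 → Module.End ℝ M) :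
    iterD D 0 = 1 := by
  simp [iterD]

theorem iterD_single {M : Type*} [AddCommMonoid M] [Module ℝ M] (D : Fin 4 → Module.End ℝ M)
    (μ : Fin 4) : iterD D (Pi.single μ 1) = D μ := by
  have h : iterD D (Pi.single μ 1) =
      D 0 ^ (Pi.single μ 1 : Fin 4 → ℕ) 0 * (D 1 ^ (Pi.single μ 1 : Fin 4 → ℕ) 1 *
        (D 2 ^ (Pi.single μ 1 : Fin 4 → ℕ) 2 * D 3 ^ (Pi.single μ 1 : Fin 4 → ℕ) 3)) := by
    rw [iterD]
    simp only [List.ofFn_succ, List.ofFn_zero, List.prod_cons, List.prod_nil, mul_one]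
    rfl
  rw [h]
  fin_cases μ <;> simp

theorem jetD_fld (μ : Fin 4) (φ : FieldComp ι) : jetD μ (fld φ) = jet (φ, Pi.single μ 1) := by
  rw [jetD, fld, superDer_jet, zero_add]

theorem totalD_tmul_one (μ : Fin 4) (x : JetAlg ι) :
    totalD μ (1 ⊗ₜ x : LocalAlg U ι) = 1 ⊗ₜ jetD μ x := by
  have : partialDeriv μ (1 : SmoothFun U) = 0 := (partialDerivation μ).map_one_eq_zero
  simp [totalD, this]

theorem totalD_field (μ : Fin 4) (φ : FieldComp ι) :
    totalD μ (field φ : LocalAlg U ι) = 1 ⊗ₜ jet (φ, Pi.single μ 1) := by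
  rw [field, totalD_tmul_one, jetD_fld]

theorem parityLoc_field (φ : FieldComp ι) :
    parityLoc (field φ : LocalAlg U ι) = (-1 : ℝ) ^ φ.parity • field φ := by
  simp [parityLoc, field, parityHom_fld, TensorProduct.tmul_smul]

theorem parityLoc_totalD_apply (μ : Fin 4) (x : LocalAlg U ι) :
    parityLoc (totalD μ x) = totalD μ (parityLoc x) :=
  LinearMap.congr_fun (parityLoc_totalD (U := U) (ι := ι) μ) x

theorem tmul_jet_mul (u v : Jet ι) :
    (1 ⊗ₜ jet u : LocalAlg U ι) * (1 ⊗ₜ jet v) =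
      (-1 : ℝ) ^ (u.1.parity * v.1.parity) • ((1 ⊗ₜ jet v) * (1 ⊗ₜ jet u)) := by
  rw [Algebra.TensorProduct.tmul_mul_tmul, jet_mul_jet, Algebra.TensorProduct.tmul_mul_tmul,
    TensorProduct.tmul_smul]

theorem evolutionary_lTensor_field (p : ℕ) (q : FieldComp ι → JetAlg ι)
    (hq : ∀ φ, parityHom (q φ) = (-1 : ℝ) ^ (p + φ.parity) • q φ) (φ : FieldComp ι) :
    (evolutionary p q hq).lTensor (SmoothFun U) (field φ) = 1 ⊗ₜ q φ := by
  rw [field, LinearMap.lTensor_tmul, evolutionary, fld, superDer_jet, iterD_zero]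
  rfl

/-- Commutation with the total derivatives is needed only on first derivatives of the fields, where
it can be read off the prolongation formula. -/
theorem evolutionary_lTensor_totalD_field (p : ℕ) (q : FieldComp ι → JetAlg ι)
    (hq : ∀ φ, parityHom (q φ) = (-1 : ℝ) ^ (p + φ.parity) • q φ) (μ : Fin 4)
    (φ : FieldComp ι) :
    (evolutionary p q hq).lTensor (SmoothFun U) (totalD μ (field φ)) =
      totalD μ (1 ⊗ₜ q φ) := by
  rw [totalD_field, LinearMap.lTensor_tmul, evolutionary, superDer_jet, iterD_single,
    totalD_tmul_one]

theorem tmul_bracket [Fintype ι] (f : ι → ι → ι → ℝ) (X Y : ι → FieldComp ι) (a : ι) :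
    (1 ⊗ₜ bracket f (fun b => fld (X b)) (fun b => fld (Y b)) a : LocalAlg U ι) =
      bracket f (fun b => field (X b)) (fun b => field (Y b)) a :=
  map_bracket f (Algebra.TensorProduct.includeRight : JetAlg ι →ₐ[ℝ] LocalAlg U ι) _ _ a

/-! ### The BRST and anti-BRST operators on products and on fields. -/

section Brst

variable [Fintype ι] (f : ι → ι → ι → ℝ) (gc ξ : ℝ)

theorem brst_mul (x y : LocalAlg U ι) :
    brst f gc ξ (x * y) = brst f gc ξ x * y + parityLoc x * brst f gc ξ y := by
  have := superDer_lTensor_mul (U := U) 1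
    (fun u : Jet ι => iterD jetD u.2 (brstChar f gc ξ u.1)) (fun u => by
      rw [parityHom_iterD, brstChar_parity f gc ξ, map_smul]) x y
  rw [pow_one] at this
  exact this

theorem antiBrst_mul (x y : LocalAlg U ι) :
    antiBrst f gc ξ (x * y) = antiBrst f gc ξ x * y + parityLoc x * antiBrst f gc ξ y := by
  have := superDer_lTensor_mul (U := U) 1
    (fun u : Jet ι => iterD jetD u.2 (antiBrstChar f gc ξ u.1)) (fun u => by
      rw [parityHom_iterD, antiBrstChar_parity f gc ξ, map_smul]) x y
  rw [pow_one] at this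
  exact this

theorem brst_coeff_mul (h : SmoothFun U) (x : LocalAlg U ι) :
    brst f gc ξ (coeff h * x) = coeff h * brst f gc ξ x :=
  superDer_lTensor_coeff_mul 1 _ (fun u => by
    rw [parityHom_iterD, brstChar_parity f gc ξ, map_smul]) h x

theorem antiBrst_coeff_mul (h : SmoothFun U) (x : LocalAlg U ι) :
    antiBrst f gc ξ (coeff h * x) = coeff h * antiBrst f gc ξ x :=
  superDer_lTensor_coeff_mul 1 _ (fun u => by
    rw [parityHom_iterD, antiBrstChar_parity f gc ξ, map_smul]) h x

theorem brst_A (μ : Fin 4) (a : ι) :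
    brst f gc ξ (A U μ a) =
      (1 / ξ) • totalD μ (gh U a) + gc • bracket f (gh U) (A U μ) a := by
  rw [brst, A, evolutionary_lTensor_field, brstChar, TensorProduct.tmul_add,
    TensorProduct.tmul_smul, TensorProduct.tmul_smul, tmul_bracket, ← totalD_tmul_one]
  rfl

theorem brst_gh (a : ι) :
    brst f gc ξ (gh U a) = (gc / 2) • bracket f (gh U) (gh U) a := by
  rw [brst, gh, evolutionary_lTensor_field, brstChar, TensorProduct.tmul_smul, tmul_bracket]
  rfl

theorem brst_agh (a : ι) : brst f gc ξ (agh U a) = (1 / ξ) • auxB U a := by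
  rw [brst, agh, evolutionary_lTensor_field, brstChar, TensorProduct.tmul_smul]
  rfl

theorem brst_auxB (a : ι) : brst f gc ξ (auxB U a) = 0 := by
  rw [brst, auxB, evolutionary_lTensor_field, brstChar, TensorProduct.tmul_zero]

theorem brst_totalD_agh (μ : Fin 4) (a : ι) :
    brst f gc ξ (totalD μ (agh U a)) = (1 / ξ) • totalD μ (auxB U a) := by
  rw [brst, agh, evolutionary_lTensor_totalD_field, brstChar, TensorProduct.tmul_smul, map_smul]
  rfl

theorem antiBrst_A (μ : Fin 4) (a : ι) :
    antiBrst f gc ξ (A U μ a) =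
      (1 / ξ) • totalD μ (agh U a) + gc • bracket f (agh U) (A U μ) a := by
  rw [antiBrst, A, evolutionary_lTensor_field, antiBrstChar, TensorProduct.tmul_add,
    TensorProduct.tmul_smul, TensorProduct.tmul_smul, tmul_bracket, ← totalD_tmul_one]
  rfl

theorem antiBrst_gh (a : ι) :
    antiBrst f gc ξ (gh U a) = -((1 / ξ) • auxB U a) + gc • bracket f (agh U) (gh U) a := by
  rw [antiBrst, gh, evolutionary_lTensor_field, antiBrstChar, TensorProduct.tmul_add,
    TensorProduct.tmul_neg, TensorProduct.tmul_smul, TensorProduct.tmul_smul, tmul_bracket]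
  rfl

theorem antiBrst_agh (a : ι) :
    antiBrst f gc ξ (agh U a) = (gc / 2) • bracket f (agh U) (agh U) a := by
  rw [antiBrst, agh, evolutionary_lTensor_field, antiBrstChar, TensorProduct.tmul_smul,
    tmul_bracket]
  rfl

end Brst

end LocalAlg

/-! ## Invariant trilinear forms -/

section Trilinear

variable {ι B : Type*} [Fintype ι] [Ring B] [Algebra ℝ B] (f : ι → ι → ι → ℝ)

/-- The trilinear expression `f_{abc} X^a Y^b Z^c`. -/
def trilinear (X Y Z : ι → B) : B := ∑ a, ∑ b, ∑ c, f a b c • (X a * Y b * Z c)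

theorem sum_mul_bracket (X Y Z : ι → B) :
    ∑ a, X a * bracket f Y Z a = trilinear f X Y Z := by
  simp only [bracket, trilinear, Finset.mul_sum, mul_smul_comm, mul_assoc]

theorem bracket_mul_bracket (X Y Z W : ι → B) (a : ι) :
    bracket f X Y a * bracket f Z W a =
      ∑ b, ∑ c, ∑ d, ∑ e, (f a b c * f a d e) • (X b * Y c * Z d * W e) := by
  simp only [bracket, Finset.sum_mul]
  refine Finset.sum_congr rfl fun b _ => Finset.sum_congr rfl fun c _ => ?_
  simp only [Finset.mul_sum, smul_mul_smul_comm, mul_assoc]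

variable {f}

/-- Invariance of the colour form, `⟨[X,Y],Z⟩ = ⟨X,[Y,Z]⟩`, with the order of the factors kept;
hence no commutation assumption enters. -/
theorem sum_bracket_mul (hcyc : ∀ a b c, f a b c = f b c a) (X Y Z : ι → B) :
    ∑ a, bracket f X Y a * Z a = trilinear f X Y Z := by
  simp only [bracket, trilinear, Finset.sum_mul, smul_mul_assoc]
  rw [Finset.sum_comm]
  refine Finset.sum_congr rfl fun b _ => ?_
  rw [Finset.sum_comm]
  refine Finset.sum_congr rfl fun c _ => Finset.sum_congr rfl fun a _ => ?_
  rw [hcyc a b c]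

/-- The structure constants absorb a cyclic relabelling, so only the sign `s` of moving the first
factor past the other two remains. -/
theorem trilinear_rotate (hcyc : ∀ a b c, f a b c = f b c a) {X Y Z : ι → B} (s : ℝ)
    (h : ∀ a b c, X a * Y b * Z c = s • (Y b * Z c * X a)) :
    trilinear f X Y Z = s • trilinear f Y Z X := by
  simp only [trilinear, Finset.smul_sum]
  rw [Finset.sum_comm]
  refine Finset.sum_congr rfl fun b _ => ?_
  rw [Finset.sum_comm]
  refine Finset.sum_congr rfl fun c _ => Finset.sum_congr rfl fun a _ => ?_
  rw [hcyc a b c, h, smul_comm]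

/-- Cyclicity and antisymmetry in the last two indices make `f` totally antisymmetric. A swap
therefore costs a sign in addition to the commutation sign `s`, and the two signs cancel for odd
factors. -/
theorem trilinear_swap (hanti : ∀ a b c, f a c b = -f a b c)
    (hcyc : ∀ a b c, f a b c = f b c a) {X Y Z : ι → B} (s : ℝ)
    (h : ∀ a b, X a * Y b = s • (Y b * X a)) :
    trilinear f X Y Z = -(s • trilinear f Y X Z) := by
  simp only [trilinear, Finset.smul_sum, ← Finset.sum_neg_distrib]
  rw [Finset.sum_comm]
  refine Finset.sum_congr rfl fun b _ => Finset.sum_congr rfl fun a _ =>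
    Finset.sum_congr rfl fun c _ => ?_
  rw [h, smul_mul_assoc, smul_comm, show f a b c = -f b a c by
    rw [hcyc a b c, hanti, ← hcyc], neg_smul, smul_neg]

/-- For odd elements the Jacobi identity gives `[x, y]_a [x, y]^a = -[x, x]_a [y, y]^a / 2`. -/
theorem sum_bracket_mul_bracket
    (hjac : ∀ b c d e, ∑ a, (f a b c * f a d e + f a b e * f a c d - f a b d * f a c e) = 0)
    (hanti : ∀ a b c, f a c b = -f a b c)
    {X Y : ι → B} (hXY : ∀ a b, Y a * X b = -(X b * Y a)) (hYY : ∀ a b, Y a * Y b = -(Y b * Y a)) :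
    (2 : ℝ) • ∑ a, bracket f X Y a * bracket f X Y a =
      -∑ a, bracket f X X a * bracket f Y Y a := by
  -- All quartic terms are brought to the ordering `X X Y Y`, so that the Jacobi identity becomes a
  -- relation between weights `w`. Anticommutation of the `Y`s makes `S` odd under exchange of its
  -- last two indices, so two of the three Jacobi terms coincide.
  let S : (ι → ι → ι → ι → ℝ) → B := fun w =>
    ∑ b, ∑ d, ∑ c, ∑ e, w b d c e • (X b * X d * Y c * Y e)
  have hS : ∀ w, S w = -S fun b d c e => w b d e c := by
    intro w
    simp only [S, ← Finset.sum_neg_distrib]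
    refine Finset.sum_congr rfl fun b _ => Finset.sum_congr rfl fun d _ => ?_
    rw [Finset.sum_comm]
    refine Finset.sum_congr rfl fun c _ => Finset.sum_congr rfl fun e _ => ?_
    rw [mul_assoc, hYY e c]
    simp [mul_assoc]
  have h1 : ∑ a, bracket f X Y a * bracket f X Y a =
      -S fun b d c e => ∑ a, f a b c * f a d e := by
    simp only [S, bracket_mul_bracket, Finset.sum_smul, ← Finset.sum_neg_distrib]
    rw [Finset.sum_comm]
    refine Finset.sum_congr rfl fun b _ => ?_
    refine (Finset.sum_congr rfl fun a _ => Finset.sum_comm).trans ?_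
    rw [Finset.sum_comm]
    refine Finset.sum_congr rfl fun d _ => ?_
    rw [Finset.sum_comm]
    refine Finset.sum_congr rfl fun c _ => ?_
    rw [Finset.sum_comm]
    refine Finset.sum_congr rfl fun e _ => Finset.sum_congr rfl fun a _ => ?_
    rw [mul_assoc (X b), hXY c d, mul_neg, neg_mul, smul_neg, ← mul_assoc]
  have h2 : ∑ a, bracket f X X a * bracket f Y Y a =
      S fun b d c e => ∑ a, f a b d * f a c e := by
    simp only [S, bracket_mul_bracket, Finset.sum_smul]
    rw [Finset.sum_comm]
    refine Finset.sum_congr rfl fun b _ => ?_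
    rw [Finset.sum_comm]
    refine Finset.sum_congr rfl fun d _ => ?_
    rw [Finset.sum_comm]
    refine Finset.sum_congr rfl fun c _ => ?_
    rw [Finset.sum_comm]
  have h3 : S (fun b d c e => ∑ a, f a b c * f a d e) +
      S (fun b d c e => ∑ a, f a b e * f a c d) - S (fun b d c e => ∑ a, f a b d * f a c e) = 0 := by
    simp only [S, ← Finset.sum_add_distrib, ← Finset.sum_sub_distrib, ← add_smul, ← sub_smul, hjac]
    simp
  have h4 : S (fun b d c e => ∑ a, f a b e * f a c d) =
      S (fun b d c e => ∑ a, f a b c * f a d e) := by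
    rw [hS]
    simp only [S, ← Finset.sum_neg_distrib, ← neg_smul]
    refine Finset.sum_congr rfl fun b _ => Finset.sum_congr rfl fun d _ =>
      Finset.sum_congr rfl fun c _ => Finset.sum_congr rfl fun e _ => ?_
    congr 1
    refine Finset.sum_congr rfl fun a _ => ?_
    rw [hanti a d e]; ring
  rw [h4] at h3
  rw [h1, h2, ← sub_eq_zero.mp h3, two_smul]
  abel

end Trilinear

/-! ### Symmetries of the structure constants. -/

section Lie

variable {𝔤 : Type*} [LieRing 𝔤] [LieAlgebra ℝ 𝔤] {ι : Type*} (T : Module.Basis ι ℝ 𝔤)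

theorem structureConst_swap (a b c : ι) :
    structureConst T a c b = -structureConst T a b c := by
  rw [structureConst, ← lie_skew, map_neg]
  rfl

variable [Fintype ι]

theorem colorMetric_basis (x : 𝔤) (a : ι) : colorMetric T x (T a) = T.repr x a := by
  classical
  simp [colorMetric, Finsupp.single_apply]

theorem colorMetric_comm (x y : 𝔤) : colorMetric T x y = colorMetric T y x :=
  Finset.sum_congr rfl fun _ _ => mul_comm _ _

/-- In an orthonormal basis `f^a_{bc} = ⟨[T_b, T_c], T_a⟩`. Ad-invariance moves `T_c` across the
form, and antisymmetry of the bracket removes the sign. -/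
theorem structureConst_cyclic
    (hT : ∀ x y z : 𝔤, colorMetric T ⁅x, y⁆ z = -colorMetric T y ⁅x, z⁆) (a b c : ι) :
    structureConst T a b c = structureConst T b c a := by
  have h := hT (T c) (T a) (T b)
  rw [colorMetric_basis, colorMetric_comm, colorMetric_basis] at h
  change structureConst T b c a = -structureConst T a c b at h
  rw [h, structureConst_swap T a c b]

/-- The `T_e` component of the Jacobi identity for `T_b, T_c, T_d`. Cyclicity brings the summed
index to the first slot of both factors, the form used in `sum_bracket_mul_bracket`. -/
theorem structureConst_jacobi
    (hT : ∀ x y z : 𝔤, colorMetric T ⁅x, y⁆ z = -colorMetric T y ⁅x, z⁆) (b c d e : ι) :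
    ∑ a, (structureConst T a b c * structureConst T a d e
      + structureConst T a b e * structureConst T a c d
      - structureConst T a b d * structureConst T a c e) = 0 := by
  have key : ∀ x y z, T.repr ⁅T x, ⁅T y, T z⁆⁆ e =
      -∑ a, structureConst T a y z * structureConst T a x e := by
    intro x y z
    conv_lhs => rw [← T.sum_repr ⁅T y, T z⁆]
    simp only [lie_sum, lie_smul, map_sum, map_smul, Finsupp.coe_finsetSum, Finset.sum_apply,
      Finsupp.smul_apply, smul_eq_mul, ← Finset.sum_neg_distrib]
    refine Finset.sum_congr rfl fun a _ => ?_
    change structureConst T a y z * structureConst T e x a = _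
    rw [← structureConst_cyclic T hT a e x, structureConst_swap T a x e, mul_neg]
  have h := congrArg (fun v => T.repr v e) (lie_jacobi (T b) (T c) (T d))
  simp only [map_add, Finsupp.add_apply, key, map_zero, Finsupp.zero_apply] at h
  simp only [Finset.sum_add_distrib, Finset.sum_sub_distrib]
  have h1 : ∑ a, structureConst T a d b * structureConst T a c e =
      -∑ a, structureConst T a b d * structureConst T a c e := by
    rw [← Finset.sum_neg_distrib]
    exact Finset.sum_congr rfl fun a _ => by rw [structureConst_swap]; ring
  have h2 : ∑ a, structureConst T a b e * structureConst T a c d =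
      ∑ a, structureConst T a c d * structureConst T a b e :=
    Finset.sum_congr rfl fun a _ => mul_comm _ _
  rw [h1] at h
  rw [h2]
  linarith

end Lie

section LocalAlg

variable {U : TopologicalSpace.Opens Coord} {ι : Type*}

/-! ### Commutation of fields -/

theorem parityLoc_A (μ : Fin 4) (a : ι) : parityLoc (A U μ a) = A U μ a := by
  simp [A, parityLoc_field, FieldComp.parity]

theorem parityLoc_auxB (a : ι) : parityLoc (auxB U a) = auxB U a := by
  simp [auxB, parityLoc_field, FieldComp.parity]

theorem parityLoc_gh (a : ι) : parityLoc (gh U a) = -gh U a := by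
  simp [gh, parityLoc_field, FieldComp.parity]

theorem parityLoc_agh (a : ι) : parityLoc (agh U a) = -agh U a := by
  simp [agh, parityLoc_field, FieldComp.parity]

theorem A_mul (μ : Fin 4) (a : ι) (x : LocalAlg U ι) : A U μ a * x = x * A U μ a :=
  (even_commute (parityLoc_A μ a) x).eq

theorem auxB_mul (a : ι) (x : LocalAlg U ι) : auxB U a * x = x * auxB U a :=
  (even_commute (parityLoc_auxB a) x).eq

theorem gh_mul_agh (a b : ι) : gh U a * agh U b = -(agh U b * gh U a) := by
  refine (tmul_jet_mul (U := U) (FieldComp.ghost a, 0)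
    (FieldComp.antighost b, 0)).trans ?_
  rw [show FieldComp.parity _ * FieldComp.parity _ = 1 from rfl, pow_one, neg_smul, one_smul]
  rfl

theorem gh_mul_gh (a b : ι) : gh U a * gh U b = -(gh U b * gh U a) := by
  refine (tmul_jet_mul (U := U) (FieldComp.ghost a, 0)
    (FieldComp.ghost b, 0)).trans ?_
  rw [show FieldComp.parity _ * FieldComp.parity _ = 1 from rfl, pow_one, neg_smul, one_smul]
  rfl

theorem totalD_agh_mul_gh (μ : Fin 4) (a b : ι) :
    totalD μ (agh U a) * gh U b = -(gh U b * totalD μ (agh U a)) := by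
  rw [agh, totalD_field]
  refine (tmul_jet_mul (U := U) (FieldComp.antighost a, Pi.single μ 1)
    (FieldComp.ghost b, 0)).trans ?_
  rw [show FieldComp.parity _ * FieldComp.parity _ = 1 from rfl, pow_one, neg_smul, one_smul]
  rfl

theorem totalD_gh_mul_totalD_agh (μ ν : Fin 4) (a b : ι) :
    totalD μ (gh U a) * totalD ν (agh U b) = -(totalD ν (agh U b) * totalD μ (gh U a)) := by
  rw [agh, gh, totalD_field, totalD_field]
  refine (tmul_jet_mul (U := U) (FieldComp.ghost a, Pi.single μ 1)
    (FieldComp.antighost b, Pi.single ν 1)).trans ?_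
  rw [show FieldComp.parity _ * FieldComp.parity _ = 1 from rfl, pow_one, neg_smul, one_smul]

/-! ### Exact computation of `𝒬G`. -/

section Densities

variable [Fintype ι] (m : LorentzMetric U) (f : ι → ι → ι → ℝ) (gc ξ : ℝ)

theorem coeff_mul_trilinear (h : SmoothFun U) (X Y Z : ι → LocalAlg U ι) :
    coeff h * trilinear f X Y Z = ∑ a, ∑ b, ∑ c, f a b c • (coeff h * (X a * Y b * Z c)) := by
  simp only [trilinear, Finset.mul_sum, mul_smul_comm]

theorem totalD_bracket (μ : Fin 4) (X Y : ι → LocalAlg U ι) (a : ι) :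
    totalD μ (bracket f X Y a) =
      bracket f (fun b => totalD μ (X b)) Y a + bracket f X (fun b => totalD μ (Y b)) a := by
  simp only [bracket, map_sum, map_smul, totalD_mul, smul_add, Finset.sum_add_distrib]

/-- `g^{μν} A^a_μ ∂_ν β_a`. -/
def gaugeDeriv (β : ι → LocalAlg U ι) : LocalAlg U ι :=
  ∑ μ, ∑ ν, ∑ a, coeff (m.inv μ ν) * (A U μ a * totalD ν (β a))

/-- `g^{μν} (∂_μ c̄_a)(∂_ν c^a)`. -/
def ghostKinetic (ι : Type*) [Fintype ι] : LocalAlg U ι :=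
  ∑ μ, ∑ ν, ∑ a, coeff (m.inv μ ν) * (totalD μ (agh U a) * totalD ν (gh U a))

/-- `g^{μν} f_{abc} (∂_μ c̄^a) c^b A^c_ν`. -/
def antighostDerivVertex : LocalAlg U ι :=
  ∑ μ, ∑ ν, coeff (m.inv μ ν) * trilinear f (fun a => totalD μ (agh U a)) (gh U) (A U ν)

/-- `g^{μν} f_{abc} c̄^a (∂_μ c^b) A^c_ν`. -/
def ghostDerivVertex : LocalAlg U ι :=
  ∑ μ, ∑ ν, coeff (m.inv μ ν) * trilinear f (agh U) (fun a => totalD μ (gh U a)) (A U ν)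

theorem fourGhost_eq : (fourGhost f : LocalAlg U ι) =
    ∑ a, bracket f (agh U) (agh U) a * bracket f (gh U) (gh U) a := by
  simp only [fourGhost, bracket_mul_bracket]

theorem antiBrst_gaugeFixingBoson (hξ : ξ ≠ 0) (hanti : ∀ a b c, f a c b = -f a b c)
    (hcyc : ∀ a b c, f a b c = f b c a) :
    antiBrst f gc ξ (gaugeFixingBoson m ξ) = coeff m.vol *
      (-gaugeDeriv m (agh U) + (1 / 2 : ℝ) • ∑ a, agh U a * auxB U a
        - (gc * ξ / 4) • trilinear f (agh U) (agh U) (gh U)) := by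
  have h1 : antiBrst f gc ξ (∑ μ, ∑ ν, ∑ a, coeff (m.inv μ ν) * (A U μ a * A U ν a)) =
      (2 / ξ) • gaugeDeriv m (agh U) := by
    have e : ∀ μ ν, ∑ a, antiBrst f gc ξ (coeff (m.inv μ ν) * (A U μ a * A U ν a)) =
        (1 / ξ) • (∑ a, coeff (m.inv μ ν) * (A U ν a * totalD μ (agh U a))) +
        (1 / ξ) • (∑ a, coeff (m.inv μ ν) * (A U μ a * totalD ν (agh U a))) := by
      intro μ ν
      -- The non-derivative part of `Q̄ A` acts as an infinitesimal colour rotation, which preserves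
      -- the invariant form `A_μ·A_ν`.
      have e1 : ∑ a, bracket f (agh U) (A U μ) a * A U ν a +
          ∑ a, A U μ a * bracket f (agh U) (A U ν) a = 0 := by
        rw [sum_bracket_mul hcyc, sum_mul_bracket,
          trilinear_swap hanti hcyc 1 (X := agh U) (Y := A U μ)
            (fun a b => by rw [one_smul, A_mul]), one_smul, neg_add_cancel]
      calc _ = (1 / ξ) • (∑ a, coeff (m.inv μ ν) * (A U ν a * totalD μ (agh U a))) +
            (1 / ξ) • (∑ a, coeff (m.inv μ ν) * (A U μ a * totalD ν (agh U a))) +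
            gc • (coeff (m.inv μ ν) * (∑ a, bracket f (agh U) (A U μ) a * A U ν a +
              ∑ a, A U μ a * bracket f (agh U) (A U ν) a)) := by
            simp only [Finset.smul_sum, Finset.mul_sum, ← Finset.sum_add_distrib]
            refine Finset.sum_congr rfl fun a _ => ?_
            rw [antiBrst_coeff_mul, antiBrst_mul, antiBrst_A, antiBrst_A, parityLoc_A,
              A_mul ν a (totalD μ (agh U a))]
            simp only [mul_add, add_mul, smul_mul_assoc, mul_smul_comm, smul_add]
            abel
        _ = _ := by rw [e1, mul_zero, smul_zero, add_zero]
    simp only [map_sum, e, Finset.sum_add_distrib, ← Finset.smul_sum]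
    rw [Finset.sum_comm]
    have e' : ∑ ν, ∑ μ, ∑ a : ι, coeff (m.inv μ ν) * (A U ν a * totalD μ (agh U a)) =
        gaugeDeriv m (agh U) := by
      rw [gaugeDeriv]
      refine Finset.sum_congr rfl fun ν _ => Finset.sum_congr rfl fun μ _ => ?_
      rw [m.inv_symm]
    rw [e', ← gaugeDeriv]
    module
  have h2 : antiBrst f gc ξ (∑ a, agh U a * gh U a) =
      (1 / ξ) • (∑ a, agh U a * auxB U a) -
        (gc / 2) • trilinear f (agh U) (agh U) (gh U) := by
    calc _ = (1 / ξ) • (∑ a, agh U a * auxB U a) +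
          (gc / 2) • (∑ a, bracket f (agh U) (agh U) a * gh U a) -
          gc • (∑ a, agh U a * bracket f (agh U) (gh U) a) := by
          simp only [Finset.smul_sum, ← Finset.sum_add_distrib, ← Finset.sum_sub_distrib, map_sum]
          refine Finset.sum_congr rfl fun a _ => ?_
          rw [antiBrst_mul, antiBrst_gh, antiBrst_agh, parityLoc_agh]
          simp only [mul_add, mul_neg, neg_mul, smul_mul_assoc, mul_smul_comm]
          module
      -- Both cubic sums are the same trilinear form in `c̄, c̄, c`, with total coefficient `gc/2 -
      -- gc = -gc/2`.
      _ = _ := by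
          rw [sum_bracket_mul hcyc, sum_mul_bracket]
          module
  rw [gaugeFixingBoson, antiBrst_coeff_mul, map_smul, map_sub, h1, h2]
  congr 1
  match_scalars <;> field_simp <;> ring

theorem brst_trilinear (X Y Z : ι → LocalAlg U ι) :
    brst f gc ξ (trilinear f X Y Z) =
      trilinear f (fun a => brst f gc ξ (X a)) Y Z
      + trilinear f (fun a => parityLoc (X a)) (fun a => brst f gc ξ (Y a)) Z
      + trilinear f (fun a => parityLoc (X a)) (fun a => parityLoc (Y a))
          (fun a => brst f gc ξ (Z a)) := by
  simp only [trilinear, ← Finset.sum_add_distrib, map_sum, map_smul, brst_mul, map_mul, add_mul,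
    smul_add]

/-- The density `𝒬 G` with `β` in place of the auxiliary field. -/
def superBrstDensity (β : ι → LocalAlg U ι) : LocalAlg U ι :=
  coeff m.vol *
    ((1 / (2 * ξ)) • (∑ a, β a * β a) - (1 / ξ) • gaugeDeriv m β
      + (1 / ξ) • ghostKinetic m ι + gc • antighostDerivVertex m f
      - (gc / 2) • (∑ a, β a * bracket f (agh U) (gh U) a) - (gc ^ 2 * ξ / 8) • fourGhost f)

theorem superBrst_gaugeFixingBoson (hξ : ξ ≠ 0) (hanti : ∀ a b c, f a c b = -f a b c)
    (hcyc : ∀ a b c, f a b c = f b c a) :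
    superBrst f gc ξ (gaugeFixingBoson m ξ) = superBrstDensity m f gc ξ (auxB U) := by
  have h1 : brst f gc ξ (gaugeDeriv m (agh U)) =
      (1 / ξ) • gaugeDeriv m (auxB U) - (1 / ξ) • ghostKinetic m ι
        - gc • antighostDerivVertex m f := by
    -- The sign comes from moving the odd `∂c̄` past the odd `c`; the even `A` contributes none.
    have hrot : ∀ μ ν, trilinear f (gh U) (A U μ) (fun a => totalD ν (agh U a)) =
        -trilinear f (fun a => totalD ν (agh U a)) (gh U) (A U μ) := by
      intro μ ν
      rw [trilinear_rotate hcyc (-1) (X := fun a => totalD ν (agh U a)) (Y := gh U)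
        (Z := A U μ) fun a b c => ?_]
      · module
      · rw [totalD_agh_mul_gh, neg_mul, neg_smul, one_smul, mul_assoc, mul_assoc, A_mul]
    have e : ∀ μ ν, ∑ a, brst f gc ξ (coeff (m.inv μ ν) * (A U μ a * totalD ν (agh U a))) =
        (1 / ξ) • (∑ a, coeff (m.inv μ ν) * (A U μ a * totalD ν (auxB U a)))
        - (1 / ξ) • (∑ a, coeff (m.inv ν μ) * (totalD ν (agh U a) * totalD μ (gh U a)))
        - gc • (coeff (m.inv ν μ) *
            trilinear f (fun a => totalD ν (agh U a)) (gh U) (A U μ)) := by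
      intro μ ν
      rw [← neg_neg (trilinear f _ _ _), ← hrot, ← sum_bracket_mul hcyc, m.inv_symm ν μ]
      simp only [Finset.smul_sum, Finset.mul_sum, mul_neg, smul_neg, sub_neg_eq_add,
        ← Finset.sum_add_distrib, ← Finset.sum_sub_distrib]
      refine Finset.sum_congr rfl fun a _ => ?_
      rw [brst_coeff_mul, brst_mul, brst_A, brst_totalD_agh, parityLoc_A, add_mul,
        smul_mul_assoc, totalD_gh_mul_totalD_agh]
      simp only [mul_add, mul_neg, smul_mul_assoc, mul_smul_comm, smul_neg]
      abel
    rw [gaugeDeriv, ghostKinetic, antighostDerivVertex,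
      Finset.sum_comm (f := fun μ ν => ∑ a, coeff (m.inv μ ν) *
        (totalD μ (agh U a) * totalD ν (gh U a))),
      Finset.sum_comm (f := fun μ ν => coeff (m.inv μ ν) *
        trilinear f (fun a => totalD μ (agh U a)) (gh U) (A U ν))]
    simp only [map_sum, e, Finset.sum_sub_distrib, ← Finset.smul_sum]
    rfl
  have h2 : brst f gc ξ (∑ a, agh U a * auxB U a) = (1 / ξ) • ∑ a, auxB U a * auxB U a := by
    simp only [map_sum, brst_mul, brst_agh, brst_auxB, mul_zero, add_zero, smul_mul_assoc,
      Finset.smul_sum]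
  have h3 : brst f gc ξ (trilinear f (agh U) (agh U) (gh U)) =
      (2 / ξ) • (∑ a, auxB U a * bracket f (agh U) (gh U) a) + (gc / 2) • fourGhost f := by
    rw [brst_trilinear, fourGhost_eq, sum_bracket_mul hcyc, sum_mul_bracket]
    simp only [brst_agh, brst_gh, parityLoc_agh]
    have e1 : trilinear f (fun a => (1 / ξ) • auxB U a) (agh U) (gh U) =
        (1 / ξ) • trilinear f (auxB U) (agh U) (gh U) := by
      simp only [trilinear, smul_mul_assoc, Finset.smul_sum, smul_comm (1 / ξ)]
    -- The Leibniz sign from passing `c̄` and the sign from antisymmetry of `f` cancel, so this term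
    -- doubles the previous one.
    have e2 : trilinear f (fun a => -agh U a) (fun a => (1 / ξ) • auxB U a) (gh U) =
        (1 / ξ) • trilinear f (auxB U) (agh U) (gh U) := by
      rw [trilinear_swap hanti hcyc 1 fun a b => by
        rw [one_smul, smul_mul_assoc, mul_smul_comm, auxB_mul]]
      simp only [trilinear, smul_mul_assoc, mul_neg, neg_mul, smul_neg, Finset.smul_sum,
        smul_comm (1 / ξ), one_smul, Finset.sum_neg_distrib, neg_neg]
    have e3 : trilinear f (fun a => -agh U a) (fun a => -agh U a)
        (fun a => (gc / 2) • bracket f (gh U) (gh U) a) =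
        (gc / 2) • trilinear f (agh U) (agh U) (bracket f (gh U) (gh U)) := by
      simp only [trilinear, neg_mul_neg, mul_smul_comm, Finset.smul_sum, smul_comm (gc / 2)]
    rw [e1, e2, e3]
    module
  rw [superBrst, LinearMap.comp_apply, antiBrst_gaugeFixingBoson m f gc ξ hξ hanti hcyc,
    brst_coeff_mul, map_sub, map_add, map_neg, map_smul, map_smul, h1, h2, h3, superBrstDensity]
  congr 1
  match_scalars <;> field_simp <;> ring

end Densities

end LocalAlg

section LocalAlg

variable {U : TopologicalSpace.Opens Coord} {ι : Type*}

/-! ### Substitution for the auxiliary field -/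

theorem substAux_coeff (β : ι → evenPart U ι) (h : SmoothFun U) :
    substAux β (coeff h) = coeff h := by
  rw [coeff, substAux, Algebra.TensorProduct.lift_tmul, map_one, mul_one]
  rfl

theorem substAux_one_tmul_jet (β : ι → evenPart U ι) (u : Jet ι) :
    substAux β (1 ⊗ₜ jet u) = substVal β u := by
  rw [substAux_tmul_jet, show (coeff 1 : LocalAlg U ι) = 1 from rfl, one_mul]

theorem substAux_A (β : ι → evenPart U ι) (μ : Fin 4) (a : ι) :
    substAux β (A U μ a) = A U μ a :=
  substAux_one_tmul_jet β _

theorem substAux_gh (β : ι → evenPart U ι) (a : ι) : substAux β (gh U a) = gh U a :=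
  substAux_one_tmul_jet β _

theorem substAux_agh (β : ι → evenPart U ι) (a : ι) : substAux β (agh U a) = agh U a :=
  substAux_one_tmul_jet β _

theorem substAux_auxB (β : ι → evenPart U ι) (a : ι) : substAux β (auxB U a) = β a := by
  refine (substAux_one_tmul_jet β _).trans ?_
  rw [substVal, iterD_zero]
  rfl

theorem substAux_totalD_A (β : ι → evenPart U ι) (μ ν : Fin 4) (a : ι) :
    substAux β (totalD ν (A U μ a)) = totalD ν (A U μ a) := by
  rw [A, totalD_field, substAux_one_tmul_jet, substVal]

theorem substAux_totalD_gh (β : ι → evenPart U ι) (ν : Fin 4) (a : ι) :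
    substAux β (totalD ν (gh U a)) = totalD ν (gh U a) := by
  rw [gh, totalD_field, substAux_one_tmul_jet, substVal]

theorem substAux_totalD_agh (β : ι → evenPart U ι) (ν : Fin 4) (a : ι) :
    substAux β (totalD ν (agh U a)) = totalD ν (agh U a) := by
  rw [agh, totalD_field, substAux_one_tmul_jet, substVal]

theorem substAux_totalD_auxB (β : ι → evenPart U ι) (ν : Fin 4) (a : ι) :
    substAux β (totalD ν (auxB U a)) = totalD ν (β a : LocalAlg U ι) := by
  rw [auxB, totalD_field, substAux_one_tmul_jet, substVal, iterD_single]

/-! ### Partial derivatives with respect to the auxiliary field -/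

theorem auxPartial_mul (a : ι) (I : Fin 4 → ℕ) (x y : LocalAlg U ι) :
    auxPartial a I (x * y) = auxPartial a I x * y + x * auxPartial a I y := by
  classical
  refine (superDer_lTensor_mul 0 _ _ x y).trans ?_
  rw [pow_zero]
  rfl

theorem auxPartial_coeff_mul (a : ι) (I : Fin 4 → ℕ) (h : SmoothFun U) (x : LocalAlg U ι) :
    auxPartial a I (coeff h * x) = coeff h * auxPartial a I x :=
  superDer_lTensor_coeff_mul 0 _ _ h x

theorem auxPartial_coeff (a : ι) (I : Fin 4 → ℕ) (h : SmoothFun U) :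
    auxPartial a I (coeff h : LocalAlg U ι) = 0 :=
  superDer_lTensor_coeff 0 _ _ h

open Classical in
theorem auxPartial_one_tmul_jet (a : ι) (I : Fin 4 → ℕ) (u : Jet ι) :
    auxPartial a I (1 ⊗ₜ jet u : LocalAlg U ι) = if u = (FieldComp.aux a, I) then 1 else 0 := by
  rw [auxPartial, LinearMap.lTensor_tmul, superDer_jet]
  split_ifs
  · rfl
  · exact TensorProduct.tmul_zero _ _

theorem auxPartial_A (a : ι) (I : Fin 4 → ℕ) (μ : Fin 4) (b : ι) :
    auxPartial a I (A U μ b) = 0 :=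
  (auxPartial_one_tmul_jet a I _).trans (if_neg (by simp))

theorem auxPartial_gh (a : ι) (I : Fin 4 → ℕ) (b : ι) : auxPartial a I (gh U b) = 0 :=
  (auxPartial_one_tmul_jet a I _).trans (if_neg (by simp))

theorem auxPartial_agh (a : ι) (I : Fin 4 → ℕ) (b : ι) : auxPartial a I (agh U b) = 0 :=
  (auxPartial_one_tmul_jet a I _).trans (if_neg (by simp))

theorem auxPartial_totalD_gh (a : ι) (I : Fin 4 → ℕ) (μ : Fin 4) (b : ι) :
    auxPartial a I (totalD μ (gh U b)) = 0 := by
  rw [gh, totalD_field, auxPartial_one_tmul_jet, if_neg (by simp)]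

theorem auxPartial_totalD_agh (a : ι) (I : Fin 4 → ℕ) (μ : Fin 4) (b : ι) :
    auxPartial a I (totalD μ (agh U b)) = 0 := by
  rw [agh, totalD_field, auxPartial_one_tmul_jet, if_neg (by simp)]

open Classical in
theorem auxPartial_auxB (a : ι) (I : Fin 4 → ℕ) (b : ι) :
    auxPartial a I (auxB U b) = if b = a then (if I = 0 then 1 else 0) else 0 := by
  refine (auxPartial_one_tmul_jet a I _).trans ?_
  simp only [Prod.mk.injEq, FieldComp.aux.injEq, ite_and, eq_comm (a := I)]

open Classical in
theorem auxPartial_totalD_auxB (a : ι) (I : Fin 4 → ℕ) (μ : Fin 4) (b : ι) :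
    auxPartial a I (totalD μ (auxB U b)) =
      if b = a then (if I = Pi.single μ 1 then 1 else 0) else 0 := by
  rw [auxB, totalD_field, auxPartial_one_tmul_jet]
  simp only [Prod.mk.injEq, FieldComp.aux.injEq, ite_and, eq_comm (a := I)]

section Divergence

variable (m : LorentzMetric U) (gc : ℝ)

/-! ### The divergence of the gauge field -/

/-- `∂_ν (√(-det g) g^{μν} A_μ) = √(-det g) g^{μν} ∇_μ A_ν`. -/
theorem sum_totalD_vol_mul (hgc : gc ≠ 0) (a : ι) :
    ∑ ν, totalD ν (coeff m.vol * ∑ μ, coeff (m.inv μ ν) * A U μ a) =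
      coeff m.vol * ((1 / gc) • lorenz m gc a) := by
  have h1 : ∀ ν, totalD ν (coeff m.vol * ∑ μ, coeff (m.inv μ ν) * A U μ a) =
      ∑ μ, coeff (partialDeriv ν (m.vol * m.inv ν μ)) * A U μ a +
        ∑ μ, coeff m.vol * (coeff (m.inv ν μ) * totalD ν (A U μ a)) := by
    intro ν
    rw [Finset.mul_sum, map_sum, ← Finset.sum_add_distrib]
    refine Finset.sum_congr rfl fun μ _ => ?_
    rw [← mul_assoc, ← coeff_mul, totalD_mul, totalD_coeff, m.inv_symm μ ν, coeff_mul, mul_assoc]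
  simp only [h1, Finset.sum_add_distrib]
  rw [Finset.sum_comm]
  have h2 : ∀ ρ, ∑ ν, coeff (partialDeriv ν (m.vol * m.inv ν ρ)) * A U ρ a =
      -∑ μ, ∑ ν, coeff m.vol * (coeff (m.inv μ ν) * (coeff (m.christoffel ρ μ ν) * A U ρ a)) := by
    intro ρ
    have h3 : coeff (-(m.vol * ∑ μ, ∑ ν, m.inv μ ν * m.christoffel ρ μ ν)) =
        -∑ μ, ∑ ν, (coeff m.vol * (coeff (m.inv μ ν) * coeff (m.christoffel ρ μ ν)) :
          LocalAlg U ι) := by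
      rw [coeff_neg, coeff_mul]
      simp only [coeff_sum, coeff_mul, Finset.mul_sum]
    rw [← Finset.sum_mul, ← coeff_sum, m.sum_partialDeriv_vol_mul_inv, h3, neg_mul]
    simp only [Finset.sum_mul, mul_assoc]
  have h4 : ∑ ρ, ∑ ν, coeff (partialDeriv ν (m.vol * m.inv ν ρ)) * A U ρ a =
      -∑ μ, ∑ ν, ∑ ρ,
        coeff m.vol * (coeff (m.inv μ ν) * (coeff (m.christoffel ρ μ ν) * A U ρ a)) := by
    rw [Finset.sum_congr rfl fun ρ _ => h2 ρ, Finset.sum_neg_distrib, neg_inj, Finset.sum_comm]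
    refine Finset.sum_congr rfl fun μ _ => ?_
    rw [Finset.sum_comm]
  rw [h4, lorenz, smul_smul, one_div_mul_cancel hgc, one_smul, neg_add_eq_sub]
  simp only [mul_sub, Finset.sum_sub_distrib, Finset.mul_sum]

/-- Evenness makes `-L/gc` an admissible value for the auxiliary field and lets `L` commute with
every local expression. -/
theorem lorenz_even (a : ι) : lorenz m gc a ∈ evenPart U ι := by
  change parityLoc _ = lorenz m gc a
  simp only [lorenz, map_smul, map_sum, map_mul, map_sub, parityLoc_coeff, parityLoc_A,
    parityLoc_totalD_apply]

/-- `L` contains only the gauge field, so the equation of motion for `b'` stays explicit after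
substitution. -/
theorem substAux_lorenz (β : ι → evenPart U ι) (a : ι) :
    substAux β (lorenz m gc a) = lorenz m gc a := by
  simp only [lorenz, map_mul, map_sub, map_smul, map_sum, substAux_coeff, substAux_A,
    substAux_totalD_A]

end Divergence

/-! ### Integration by parts, the shifted density and its equation of motion. -/

section Densities

variable [Fintype ι] (m : LorentzMetric U) (f : ι → ι → ι → ℝ) (gc ξ : ℝ)

/-- Integration by parts of `g^{μν} A^a_μ ∂_ν β_a dV_g`. -/
theorem vol_mul_gaugeDeriv (hgc : gc ≠ 0) (β : ι → LocalAlg U ι) :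
    coeff m.vol * gaugeDeriv m β + (1 / gc) • (coeff m.vol * ∑ a, β a * lorenz m gc a) =
      ∑ ν, totalD ν (∑ a, (coeff m.vol * ∑ μ, coeff (m.inv μ ν) * A U μ a) * β a) := by
  have h1 : ∑ ν, ∑ a, totalD ν (coeff m.vol * ∑ μ, coeff (m.inv μ ν) * A U μ a) * β a =
      (1 / gc) • (coeff m.vol * ∑ a, β a * lorenz m gc a) := by
    rw [Finset.sum_comm, Finset.mul_sum, Finset.smul_sum]
    refine Finset.sum_congr rfl fun a _ => ?_
    rw [← Finset.sum_mul, sum_totalD_vol_mul m gc hgc,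
      (even_commute (lorenz_even m gc a) (β a)).symm.eq]
    simp only [mul_smul_comm, smul_mul_assoc, mul_assoc]
  have h2 : ∑ ν, ∑ a, (coeff m.vol * ∑ μ, coeff (m.inv μ ν) * A U μ a) * totalD ν (β a) =
      coeff m.vol * gaugeDeriv m β := by
    rw [gaugeDeriv, Finset.sum_comm (s := Finset.univ (α := Fin 4)) (t := Finset.univ (α := Fin 4)),
      Finset.mul_sum]
    refine Finset.sum_congr rfl fun ν _ => ?_
    rw [Finset.sum_comm, Finset.mul_sum]
    refine Finset.sum_congr rfl fun a _ => ?_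
    simp only [Finset.mul_sum, Finset.sum_mul, mul_assoc]
  simp only [map_sum, totalD_mul _ _ (β _), Finset.sum_add_distrib]
  rw [h1, h2, add_comm]

/-- Integration by parts in the shape needed for whole densities. It is applied once with `β = b`
and once with `β = -L/gc`. -/
theorem gaugeDeriv_eqModDiv (hgc : gc ≠ 0) (r : ℝ) (β : ι → LocalAlg U ι) (Y : LocalAlg U ι)
    {X Z : LocalAlg U ι} (hX : X = coeff m.vol * (r • gaugeDeriv m β + Y))
    (hZ : Z = coeff m.vol * (-(r / gc) • (∑ a, β a * lorenz m gc a) + Y)) :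
    EqModDiv X Z := by
  refine ⟨fun ν => r • ∑ a, (coeff m.vol * ∑ μ, coeff (m.inv μ ν) * A U μ a) * β a, ?_⟩
  simp only [map_smul, ← Finset.smul_sum]
  rw [← vol_mul_gaugeDeriv m gc hgc, hX, hZ]
  simp only [mul_add, mul_smul_comm]
  module

/-! ### The Lagrange densities -/

theorem eqModDiv_auxDensity (hgc : gc ≠ 0) :
    EqModDiv (superBrstDensity m f gc ξ (auxB U)) (auxDensity m f gc ξ) := by
  have h1 : ∑ a, ∑ b, ∑ c, f a b c • (auxB U a * agh U b * gh U c) =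
      ∑ a, auxB U a * bracket f (agh U) (gh U) a := (sum_mul_bracket f _ _ _).symm
  refine gaugeDeriv_eqModDiv m gc hgc (-(1 / ξ)) (auxB U)
    ((1 / (2 * ξ)) • (∑ a, auxB U a * auxB U a)
      + (1 / ξ) • ghostKinetic m ι + gc • antighostDerivVertex m f
      - (gc / 2) • (∑ a, auxB U a * bracket f (agh U) (gh U) a)
      - (gc ^ 2 * ξ / 8) • fourGhost f) ?_ ?_
  · rw [superBrstDensity]
    congr 1
    module
  · rw [auxDensity, h1, ghostKinetic, antighostDerivVertex]
    simp only [coeff_mul_trilinear]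
    congr 1
    match_scalars <;> field_simp

theorem substAux_superBrstDensity (β : ι → evenPart U ι) :
    substAux β (superBrstDensity m f gc ξ (auxB U)) =
      superBrstDensity m f gc ξ fun a => (β a : LocalAlg U ι) := by
  simp only [superBrstDensity, gaugeDeriv, ghostKinetic, antighostDerivVertex, trilinear,
    fourGhost, bracket, map_mul, map_add, map_sub, map_smul, map_sum, substAux_coeff, substAux_A,
    substAux_gh, substAux_agh, substAux_auxB, substAux_totalD_gh, substAux_totalD_agh,
    substAux_totalD_auxB]

/-- The part of the shifted density that does not contain the auxiliary field. -/
def ghostDensity : LocalAlg U ι :=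
  (1 / ξ) • ghostKinetic m ι + (gc / 2) • (antighostDerivVertex m f - ghostDerivVertex m f)
    - (gc ^ 2 * ξ / 16) • fourGhost f

/-- The density `𝒬 G` as a function of the shifted auxiliary field `β`. -/
def shiftedDensity (β : ι → LocalAlg U ι) : LocalAlg U ι :=
  coeff m.vol *
    ((1 / (2 * ξ)) • (∑ a, β a * β a) - (1 / ξ) • gaugeDeriv m β + ghostDensity m f gc ξ)

/-- The Leibniz rule on `∂[c̄,c]` gives one vertex for each differentiated ghost; the even `A`
rotates to the last slot without a sign. -/
theorem gaugeDeriv_bracket (hcyc : ∀ a b c, f a b c = f b c a) :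
    gaugeDeriv m (bracket f (agh U) (gh U)) =
      antighostDerivVertex m f + ghostDerivVertex m f := by
  have h : ∀ μ ν, ∑ a, coeff (m.inv μ ν) * (A U μ a * totalD ν (bracket f (agh U) (gh U) a)) =
      coeff (m.inv ν μ) * trilinear f (fun a => totalD ν (agh U a)) (gh U) (A U μ) +
      coeff (m.inv ν μ) * trilinear f (agh U) (fun a => totalD ν (gh U a)) (A U μ) := by
    intro μ ν
    have e : ∀ X Y : ι → LocalAlg U ι,
        trilinear f X Y (A U μ) = ∑ a, A U μ a * bracket f X Y a := fun X Y => by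
      rw [sum_mul_bracket, trilinear_rotate hcyc 1 (X := A U μ) fun a b c => by
        rw [one_smul, mul_assoc, A_mul], one_smul]
    simp only [totalD_bracket, mul_add, Finset.sum_add_distrib, e, Finset.mul_sum,
      m.inv_symm ν μ]
  rw [gaugeDeriv, antighostDerivVertex, ghostDerivVertex, Finset.sum_comm]
  simp only [h, Finset.sum_add_distrib]

/-- Completing the square. With `k = gc ξ/2` and `B = [c̄,c]`, the `β·B` terms have coefficient `k/ξ
- gc/2 = 0`, and the `B²` terms have `k²/(2ξ) - gc k/2 = -gc² ξ/8`. The derivative term contributes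
`-gc/2` times both vertices, which symmetrizes the original one. -/
theorem superBrstDensity_shift (hξ : ξ ≠ 0) (hanti : ∀ a b c, f a c b = -f a b c)
    (hcyc : ∀ a b c, f a b c = f b c a)
    (hjac : ∀ b c d e, ∑ a, (f a b c * f a d e + f a b e * f a c d - f a b d * f a c e) = 0)
    (β : ι → LocalAlg U ι) :
    superBrstDensity m f gc ξ (fun a => β a + (gc * ξ / 2) • bracket f (agh U) (gh U) a) =
      shiftedDensity m f gc ξ β := by
  have hB : ∀ a, parityLoc (bracket f (agh U) (gh U) a) = bracket f (agh U) (gh U) a := by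
    intro a
    simp only [bracket, map_sum, map_smul, map_mul, parityLoc_agh, parityLoc_gh, neg_mul_neg]
  have h1 : ∑ a, (β a + (gc * ξ / 2) • bracket f (agh U) (gh U) a) *
      (β a + (gc * ξ / 2) • bracket f (agh U) (gh U) a) =
      ∑ a, β a * β a + (gc * ξ) • (∑ a, β a * bracket f (agh U) (gh U) a)
      + (gc * ξ / 2) ^ 2 • ∑ a, bracket f (agh U) (gh U) a * bracket f (agh U) (gh U) a := by
    simp only [Finset.smul_sum, ← Finset.sum_add_distrib]
    refine Finset.sum_congr rfl fun a _ => ?_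
    simp only [mul_add, add_mul, smul_mul_assoc, mul_smul_comm,
      (even_commute (hB a) (β a)).eq]
    module
  have h2 : ∑ a, (β a + (gc * ξ / 2) • bracket f (agh U) (gh U) a) *
      bracket f (agh U) (gh U) a = ∑ a, β a * bracket f (agh U) (gh U) a
      + (gc * ξ / 2) • ∑ a, bracket f (agh U) (gh U) a * bracket f (agh U) (gh U) a := by
    simp only [Finset.smul_sum, ← Finset.sum_add_distrib, add_mul, smul_mul_assoc]
  have h3 : gaugeDeriv m (fun a => β a + (gc * ξ / 2) • bracket f (agh U) (gh U) a) =
      gaugeDeriv m β + (gc * ξ / 2) • (antighostDerivVertex m f + ghostDerivVertex m f) := by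
    rw [← gaugeDeriv_bracket m f hcyc]
    simp only [gaugeDeriv, map_add, map_smul, mul_add, mul_smul_comm, Finset.sum_add_distrib,
      Finset.smul_sum]
  -- This turns `-(gc² ξ/8) B²` into `+(gc² ξ/16)` times the four-ghost term, halving the original
  -- coefficient `-gc² ξ/8`.
  have h4 : ∑ a, bracket f (agh U) (gh U) a * bracket f (agh U) (gh U) a =
      -((1 / 2 : ℝ) • fourGhost f) := by
    have := sum_bracket_mul_bracket hjac hanti (X := agh U) (Y := gh U) gh_mul_agh gh_mul_gh
    rw [← fourGhost_eq] at this
    rw [← smul_neg, ← this]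
    module
  rw [superBrstDensity, shiftedDensity, h1, h2, h3, h4, ghostDensity]
  congr 1
  match_scalars <;> field_simp <;> ring

theorem substAux_shiftedDensity (β : ι → evenPart U ι) :
    substAux β (shiftedDensity m f gc ξ (auxB U)) =
      shiftedDensity m f gc ξ fun a => (β a : LocalAlg U ι) := by
  simp only [shiftedDensity, ghostDensity, gaugeDeriv, ghostKinetic, antighostDerivVertex,
    ghostDerivVertex, trilinear,
    fourGhost, map_mul, map_add, map_sub, map_smul, map_sum, substAux_coeff, substAux_A,
    substAux_gh, substAux_agh, substAux_auxB, substAux_totalD_gh, substAux_totalD_agh,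
    substAux_totalD_auxB]

theorem auxPartial_ghostDensity (a : ι) (I : Fin 4 → ℕ) :
    auxPartial a I (ghostDensity m f gc ξ) = 0 := by
  simp only [ghostDensity, ghostKinetic, antighostDerivVertex, ghostDerivVertex, trilinear,
    fourGhost, auxPartial_mul, auxPartial_coeff, map_add, map_sub, map_smul, map_sum,
    auxPartial_A, auxPartial_gh, auxPartial_agh, auxPartial_totalD_gh, auxPartial_totalD_agh,
    mul_zero, zero_mul, add_zero, smul_zero, Finset.sum_const_zero, sub_zero]

open Classical in
-- Only `b` itself and its first derivatives occur, the latter through `A·∂b`, so the multi-indices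
-- that matter are `0` and the four unit vectors.
theorem auxPartial_shiftedDensity (hξ : ξ ≠ 0) (a : ι) (I : Fin 4 → ℕ) :
    auxPartial a I (shiftedDensity m f gc ξ (auxB U)) =
      (if I = 0 then (1 / ξ) • (coeff m.vol * auxB U a) else 0) -
        ∑ ν, if I = Pi.single ν 1 then
          (1 / ξ) • (coeff m.vol * ∑ μ, coeff (m.inv μ ν) * A U μ a) else 0 := by
  have h1 : auxPartial a I (∑ b, auxB U b * auxB U b) =
      if I = 0 then (2 : ℝ) • auxB U a else 0 := by
    simp only [map_sum, auxPartial_mul, auxPartial_auxB]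
    split_ifs <;> simp [Finset.sum_add_distrib, two_smul]
  have h2 : auxPartial a I (gaugeDeriv m (auxB U)) =
      ∑ ν, if I = Pi.single ν 1 then ∑ μ, coeff (m.inv μ ν) * A U μ a else 0 := by
    rw [gaugeDeriv, Finset.sum_comm]
    simp only [map_sum, auxPartial_coeff, auxPartial_mul, auxPartial_A, zero_mul, zero_add,
      auxPartial_totalD_auxB]
    refine Finset.sum_congr rfl fun ν _ => ?_
    split_ifs <;> simp
  rw [shiftedDensity, auxPartial_coeff_mul, map_add, map_sub, map_smul, map_smul, h1, h2,
    auxPartial_ghostDensity, add_zero, mul_sub, mul_smul_comm, mul_smul_comm, Finset.mul_sum,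
    Finset.smul_sum]
  congr 1
  · split_ifs
    · rw [mul_smul_comm, smul_smul]
      congr 1
      field_simp
    · simp
  · refine Finset.sum_congr rfl fun ν _ => ?_
    split_ifs <;> simp

theorem eulerAux_shiftedDensity (hgc : gc ≠ 0) (hξ : ξ ≠ 0) (a : ι) :
    eulerAux a (shiftedDensity m f gc ξ (auxB U)) =
      (1 / ξ) • (coeff m.vol * (auxB U a + (1 / gc) • lorenz m gc a)) := by
  classical
  -- For a unit multi-index the sign `(-1)^{|I|} = -1` cancels the minus sign in front of `A·∂b`.
  have h : ∀ I : Fin 4 → ℕ, (-1 : ℝ) ^ (∑ μ, I μ) •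
      iterD totalD I (auxPartial a I (shiftedDensity m f gc ξ (auxB U))) =
      (if I = 0 then (1 / ξ) • (coeff m.vol * auxB U a) else 0) +
        ∑ ν, if I = Pi.single ν 1 then (1 / ξ) • totalD ν
          (coeff m.vol * ∑ μ, coeff (m.inv μ ν) * A U μ a) else 0 := by
    intro I
    rw [auxPartial_shiftedDensity m f gc ξ hξ, map_sub, map_sum, smul_sub, Finset.smul_sum,
      sub_eq_add_neg, ← Finset.sum_neg_distrib]
    congr 1
    · split_ifs with hI
      · subst hI
        simp [iterD_zero]
      · simp
    · refine Finset.sum_congr rfl fun ν _ => ?_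
      split_ifs with hI
      · subst hI
        rw [iterD_single, map_smul]
        simp
      · simp
  have hsingle : ∀ (J : Fin 4 → ℕ) (X : LocalAlg U ι),
      (∑ᶠ I, if I = J then X else 0) = X := by
    intro J X
    rw [finsum_eq_single _ J fun I hI => if_neg hI, if_pos rfl]
  -- A `finsum` splits over addition only for finite supports; here the supports lie in `{0}` and in
  -- the set of unit multi-indices.
  have hfin : ∀ (J : Fin 4 → ℕ) (X : LocalAlg U ι),
      (Function.support fun I => if I = J then X else 0).Finite := fun J X =>
    (Set.finite_singleton J).subset fun I hI => by
      by_contra hne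
      exact hI (if_neg hne)
  have hfinsum : (Function.support fun I : Fin 4 → ℕ => ∑ ν, if I = Pi.single ν 1 then
      (1 / ξ) • totalD ν (coeff m.vol * ∑ μ, coeff (m.inv μ ν) * A U μ a) else 0).Finite :=
    (Set.finite_range fun ν : Fin 4 => (Pi.single ν 1 : Fin 4 → ℕ)).subset fun I hI => by
      by_contra hne
      exact hI (Finset.sum_eq_zero fun ν _ => if_neg fun h => hne ⟨ν, h.symm⟩)
  rw [eulerAux, finsum_congr h, finsum_add_distrib (hfin _ _) hfinsum, hsingle,
    finsum_sum_comm _ _ fun ν _ => hfin _ _]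
  simp only [hsingle]
  rw [← Finset.smul_sum, sum_totalD_vol_mul m gc hgc, mul_add, smul_add]

/-- The equation is algebraic in `b'`, with invertible prefactors `1/ξ` and `√(-det g)`; this gives
existence and uniqueness together. -/
theorem substAux_eulerAux_eq_zero_iff (hgc : gc ≠ 0) (hξ : ξ ≠ 0) (β : ι → evenPart U ι) (a : ι) :
    substAux β (eulerAux a (shiftedDensity m f gc ξ (auxB U))) = 0 ↔
      (β a : LocalAlg U ι) = -((1 / gc) • lorenz m gc a) := by
  rw [eulerAux_shiftedDensity m f gc ξ hgc hξ, map_smul, map_mul, map_add, map_smul,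
    substAux_coeff, substAux_auxB, substAux_lorenz, smul_eq_zero_iff_right (one_div_ne_zero hξ),
    (isUnit_coeff m.isUnit_vol).mul_right_eq_zero, add_eq_zero_iff_eq_neg]

/-- The square contributes `1/(2 ξ gc²)` to the coefficient of `L²`, and the integrated derivative
term contributes `-1/(ξ gc²)`; the sum is `-1/(2 ξ gc²)`. -/
theorem eqModDiv_symmetricDensity (hgc : gc ≠ 0) (hξ : ξ ≠ 0) :
    EqModDiv (shiftedDensity m f gc ξ fun a => -((1 / gc) • lorenz m gc a))
      (symmetricDensity m f gc ξ) := by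
  have h1 : ∑ a : ι, -((1 / gc) • lorenz m gc a) * -((1 / gc) • lorenz m gc a) =
      (1 / gc ^ 2) • ∑ a, lorenz m gc a * lorenz m gc a := by
    simp only [neg_mul_neg, smul_mul_smul_comm, Finset.smul_sum]
    congr! 2
    field_simp
  have h2 : ∑ a : ι, -((1 / gc) • lorenz m gc a) * lorenz m gc a =
      -((1 / gc) • ∑ a, lorenz m gc a * lorenz m gc a) := by
    simp only [neg_mul, smul_mul_assoc, Finset.smul_sum, Finset.sum_neg_distrib]
  have h3 : ∑ μ, ∑ ν, ∑ a, ∑ b, ∑ c, f a b c • (coeff (m.inv μ ν) *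
      (totalD μ (agh U a) * gh U b * A U ν c - agh U a * totalD μ (gh U b) * A U ν c)) =
      antighostDerivVertex m f - ghostDerivVertex m f := by
    simp only [antighostDerivVertex, ghostDerivVertex, coeff_mul_trilinear, mul_sub, smul_sub,
      Finset.sum_sub_distrib]
  refine gaugeDeriv_eqModDiv m gc hgc (-(1 / ξ)) (fun a => -((1 / gc) • lorenz m gc a))
    ((1 / (2 * ξ)) • (1 / gc ^ 2) • (∑ a, lorenz m gc a * lorenz m gc a)
      + ghostDensity m f gc ξ) ?_ ?_
  · rw [shiftedDensity, h1]
    congr 1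
    module
  · rw [symmetricDensity, h2, h3, ← ghostKinetic, ghostDensity]
    congr 1
    match_scalars <;> field_simp
    norm_num

theorem shift_shiftedAux (a : ι) : shift f gc ξ (shiftedAux f gc ξ a) = auxB U a := by
  rw [shiftedAux, shift, map_sub, map_smul, map_bracket, substAux_auxB]
  simp only [substAux_agh, substAux_gh]
  exact add_sub_cancel_right _ _

end Densities

end LocalAlg

end QYM

end

/-! ### Assembly of the three claims. -/

theorem mainTheorem2
    {U : TopologicalSpace.Opens QYM.Coord} (m : QYM.LorentzMetric U)
    {𝔤 : Type*} [LieRing 𝔤] [LieAlgebra ℝ 𝔤] {ι : Type*} [Fintype ι] (T : Module.Basis ι ℝ 𝔤)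
    (hT : ∀ x y z : 𝔤, QYM.colorMetric T ⁅x, y⁆ z = -QYM.colorMetric T y ⁅x, z⁆)
    (gc ξ : ℝ) (hgc : gc ≠ 0) (hξ : ξ ≠ 0)
    (f : ι → ι → ι → ℝ) (hf : f = QYM.structureConst T)
    (QG : QYM.LocalAlg U ι) (hQG : QG = QYM.superBrst f gc ξ (QYM.gaugeFixingBoson m ξ)) :
    -- the density with the auxiliary field
    QYM.EqModDiv QG (QYM.auxDensity m f gc ξ) ∧
    -- the change of variables to the shifted auxiliary field
    (∀ a, QYM.shift f gc ξ (QYM.shiftedAux f gc ξ a) = QYM.auxB U a) ∧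
    -- the equation of motion of the shifted auxiliary field has the unique solution `-L^a / gc`
    (∀ β : ι → QYM.evenPart U ι,
      (∀ a, QYM.substAux β (QYM.eulerAux a (QYM.shift f gc ξ QG)) = 0) ↔
        ∀ a, (β a : QYM.LocalAlg U ι) = -((1 / gc) • QYM.lorenz m gc a)) ∧
    -- inserting a solution yields the symmetric density, and a solution exists
    (∃ β : ι → QYM.evenPart U ι,
      (∀ a, QYM.substAux β (QYM.eulerAux a (QYM.shift f gc ξ QG)) = 0) ∧
      QYM.EqModDiv (QYM.substAux β (QYM.shift f gc ξ QG)) (QYM.symmetricDensity m f gc ξ)) := by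
  subst hf
  have hanti := QYM.structureConst_swap T
  have hcyc := QYM.structureConst_cyclic T hT
  have hQ : QG = QYM.superBrstDensity m (QYM.structureConst T) gc ξ (QYM.auxB U) :=
    hQG.trans (QYM.superBrst_gaugeFixingBoson m _ gc ξ hξ hanti hcyc)
  -- The shift is applied to the exact `𝒬G`, not to a representative modulo divergences, so the
  -- Euler–Lagrange derivative below is that of the actual density.
  have hshift : QYM.shift (QYM.structureConst T) gc ξ QG =
      QYM.shiftedDensity m (QYM.structureConst T) gc ξ (QYM.auxB U) := by
    rw [hQ, QYM.shift, QYM.substAux_superBrstDensity]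
    exact QYM.superBrstDensity_shift m _ gc ξ hξ hanti hcyc
      (QYM.structureConst_jacobi T hT) (QYM.auxB U)
  have hEuler : ∀ β : ι → QYM.evenPart U ι,
      (∀ a, QYM.substAux β (QYM.eulerAux a (QYM.shift (QYM.structureConst T) gc ξ QG)) = 0) ↔
        ∀ a, (β a : QYM.LocalAlg U ι) = -((1 / gc) • QYM.lorenz m gc a) := fun β => by
    rw [hshift]
    exact forall_congr' fun a => QYM.substAux_eulerAux_eq_zero_iff m _ gc ξ hgc hξ β a
  refine ⟨?_, QYM.shift_shiftedAux _ gc ξ, hEuler, fun a => ⟨-((1 / gc) • QYM.lorenz m gc a),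
    neg_mem (Subalgebra.smul_mem _ (QYM.lorenz_even m gc a) _)⟩, (hEuler _).mpr fun a => rfl, ?_⟩
  · rw [hQ]
    exact QYM.eqModDiv_auxDensity m _ gc ξ hgc
  · rw [hshift, QYM.substAux_shiftedDensity]
    exact QYM.eqModDiv_symmetricDensity m _ gc ξ hgc hξ
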